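/- **Theorem 1.3 (Dirac–Hardy inequality).** Let $\omega\in(0,2\pi]$ and let $S_\omega:=\{(r\cos\theta,r\sin\theta)\in\mathbb R^2: r>0,\ 0<\theta<\omega\}$. Let $\sigma_1=\begin{pmatrix}0&1\\1&0\end{pmatrix}$, $\sigma_2=\begin{pmatrix}0&-i\\i&0\end{pmatrix}$, $\sigma_3=\begin{pmatrix}1&0\\0&-1\end{pmatrix}$ be the Pauli matrices, and write $\boldsymbol\sigma\cdot\nabla=\sigma_1\partial_1+\sigma_2\partial_2$ and $\boldsymbol\sigma\cdot\mathbf n=n_1\sigma_1+n_2\sigma_2$. Let $\mathcal B_{\mathbf n}:=-i\,\sigma_3\,\boldsymbol\sigma\cdot\mathbf n$, where $\mathbf n$ is the outward unit normal to $S_\omega$, that is, $\mathbf n=(0,-1)$ on the edge $\theta=0$ and $\mathbf n=(-\sin\omega,\cos\omega)$ on the edge $\theta=\omega$. Let $$\mathcal D(H_\omega):=\{\psi\in H^1(S_\omega;\mathbb C^2):\ \mathcal B_{\mathbf n}\psi=\psi\ \text{ on }\partial S_\omega\},$$ where the boundary condition is understood for the boundary traces of $\psi$ on the two edges (for $\omega=2\pi$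 the edges are the two sides of the half-line $\{(x_1,0):x_1>0\}$, with one trace from each side). Then for every $\psi\in\mathcal D(H_\omega)$ $$\int_{S_\omega}|\boldsymbol\sigma\cdot\nabla\psi|^2\,dx\ \ge\ \frac{(\pi-\omega)^2}{4\omega^2}\int_{S_\omega}\frac{|\psi|^2}{|x|^2}\,dx,$$ where the integrals are taken in $[0,\infty]$ and $0\cdot\infty=0$ if $\omega=\pi$. In particular, for $\omega\neq\pi$ the integral on the right is finite. -/

import Mathlib

open MeasureTheory Filter Topology Set
open scoped Matrix

namespace DiracSector

/-- The Euclidean plane `ℝ²`, with Euclidean norm and Lebesgue measure. -/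
abbrev Plane : Type := EuclideanSpace ℝ (Fin 2)

/-- The space `ℂ²` of spinors, with its Hermitian norm. -/
abbrev Spinor : Type := EuclideanSpace ℂ (Fin 2)

/-! ### Sectors -/

/-- The radial unit vector `e_r(θ) = (cos θ, sin θ)`. -/
noncomputable def er (θ : ℝ) : Plane := !₂[Real.cos θ, Real.sin θ]

/-- The angular unit vector `e_θ(θ) = (-sin θ, cos θ)`. -/
noncomputable def eth (θ : ℝ) : Plane := !₂[-Real.sin θ, Real.cos θ]

/-- The open sector `{(r cos θ, r sin θ) : r > 0, α < θ < β}`. -/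
def sectorBetween (α β : ℝ) : Set Plane :=
  {x | ∃ r θ : ℝ, 0 < r ∧ α < θ ∧ θ < β ∧ x = !₂[r * Real.cos θ, r * Real.sin θ]}

/-- The open sector `S_ω` of aperture `ω`; for `ω = 2π` it is the slit plane. -/
def sector (ω : ℝ) : Set Plane := sectorBetween 0 ω

/-! ### Pauli matrices and the boundary matrix -/

/-- The Pauli matrix `σ₁`. -/
def σ₁ : Matrix (Fin 2) (Fin 2) ℂ := !![0, 1; 1, 0]

/-- The Pauli matrix `σ₂`. -/
def σ₂ : Matrix (Fin 2) (Fin 2) ℂ := !![0, -Complex.I; Complex.I, 0]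

/-- The Pauli matrix `σ₃`. -/
def σ₃ : Matrix (Fin 2) (Fin 2) ℂ := !![1, 0; 0, -1]

/-- The action of a matrix on a spinor. -/
noncomputable def act (A : Matrix (Fin 2) (Fin 2) ℂ) (v : Spinor) : Spinor :=
  WithLp.toLp 2 (A *ᵥ WithLp.ofLp v)

/-- `σ · n = n₁ σ₁ + n₂ σ₂` for a vector `n` of the plane. -/
noncomputable def sigmaDot (n : Plane) : Matrix (Fin 2) (Fin 2) ℂ :=
  (n 0 : ℂ) • σ₁ + (n 1 : ℂ) • σ₂

/-- The infinite mass boundary matrix `B_n = -i σ₃ (σ · n)`. -/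
noncomputable def boundaryMatrix (n : Plane) : Matrix (Fin 2) (Fin 2) ℂ :=
  (-Complex.I) • (σ₃ * sigmaDot n)

/-! ### The Sobolev space `H¹` -/

/-- The classical partial derivative `∂_j f`. -/
noncomputable def partialDeriv {F : Type} [NormedAddCommGroup F] [NormedSpace ℝ F]
    (j : Fin 2) (f : Plane → F) (x : Plane) : F :=
  fderiv ℝ f x (EuclideanSpace.single j 1)

/-- `v` belongs to `L²(Ω; ℂ²)` and is the weak partial derivative `∂_j u` on the open set `Ω`:
`∫_Ω (∂_j φ) u = - ∫_Ω φ v` for every `φ ∈ C_c^∞(Ω)`. -/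
def IsWeakPartial (Ω : Set Plane) (j : Fin 2) (u v : Plane → Spinor) : Prop :=
  MemLp v 2 (volume.restrict Ω) ∧
    ∀ φ : Plane → ℝ, ContDiff ℝ (⊤ : ℕ∞) φ → HasCompactSupport φ → tsupport φ ⊆ Ω →
      ∫ x in Ω, partialDeriv j φ x • u x = -∫ x in Ω, φ x • v x

/-- `u ∈ H¹(Ω; ℂ²)`: `u` and its first weak partial derivatives are in `L²(Ω; ℂ²)`. -/
def MemH1 (Ω : Set Plane) (u : Plane → Spinor) : Prop :=
  MemLp u 2 (volume.restrict Ω) ∧ ∀ j, ∃ v, IsWeakPartial Ω j u v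

open Classical in
/-- The weak partial derivative `∂_j u` of `u ∈ H¹(Ω; ℂ²)`, unique up to equality a.e. on `Ω`
(and `0` if there is none in `L²`). -/
noncomputable def weakPartial (Ω : Set Plane) (j : Fin 2) (u : Plane → Spinor) :
    Plane → Spinor :=
  if h : ∃ v, IsWeakPartial Ω j u v then h.choose else 0

/-- `σ · ∇ψ = σ₁ ∂₁ψ + σ₂ ∂₂ψ` on `Ω`, with weak derivatives. -/
noncomputable def sigmaGrad (Ω : Set Plane) (ψ : Plane → Spinor) (x : Plane) : Spinor :=
  act σ₁ (weakPartial Ω 0 ψ x) + act σ₂ (weakPartial Ω 1 ψ x)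

/-! ### Boundary traces on the edges and the infinite mass condition -/

/-- Let `Ω` be a convex sector, of which the half-line `{r e_r(θ) : r > 0}` is an edge, and let
`u ∈ H¹(Ω; ℂ²)`. Then `g ∈ L²((0,∞); ℂ²)`, where `g r` stands for the value at `r e_r(θ)`, is the
boundary trace of `u` on this edge: the trace operator is the continuous extension to `H¹(Ω)` of
the restriction to the edge, from the dense subspace of restrictions to `Ω` of functions in
`C_c^∞(ℝ²)`. -/
def IsEdgeTrace (Ω : Set Plane) (θ : ℝ) (u : Plane → Spinor) (g : ℝ → Spinor) : Prop :=
  MemLp g 2 (volume.restrict (Ioi (0 : ℝ))) ∧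
  ∃ U : ℕ → Plane → Spinor,
    (∀ n, ContDiff ℝ (⊤ : ℕ∞) (U n) ∧ HasCompactSupport (U n)) ∧
    Tendsto (fun n => eLpNorm (fun x => U n x - u x) 2 (volume.restrict Ω)) atTop (𝓝 0) ∧
    (∀ j, Tendsto (fun n => eLpNorm (fun x => partialDeriv j (U n) x - weakPartial Ω j u x) 2
      (volume.restrict Ω)) atTop (𝓝 0)) ∧
    Tendsto (fun n => eLpNorm (fun r => U n (r • er θ) - g r) 2
      (volume.restrict (Ioi (0 : ℝ)))) atTop (𝓝 0)

/-- On the edge at angle `θ` of the sector `Ω`, with unit normal `n`, the trace of `u` satisfies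
`B_n u = u` almost everywhere. -/
def EdgeCondition (Ω : Set Plane) (θ : ℝ) (n : Plane) (u : Plane → Spinor) : Prop :=
  ∃ g : ℝ → Spinor, IsEdgeTrace Ω θ u g ∧
    ∀ᵐ r ∂(volume.restrict (Ioi (0 : ℝ))), act (boundaryMatrix n) (g r) = g r

/-- The domain `D(H_ω)`: functions in `H¹(S_ω; ℂ²)` with `B_n ψ = ψ` on `∂S_ω`, where `n` is the
outward normal, `-e_θ(0) = (0,-1)` on the edge `θ = 0` and `e_θ(ω)` on the edge `θ = ω`.
The trace on each edge is taken from the half of `S_ω` adjacent to it. The halves are convex since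
`ω ≤ 2π`, and for `ω = 2π` they separate the two sides of the slit. -/
def diracDomain (ω : ℝ) : Set (Plane → Spinor) :=
  {ψ | MemH1 (sector ω) ψ ∧
    EdgeCondition (sectorBetween 0 (ω / 2)) 0 (-eth 0) ψ ∧
    EdgeCondition (sectorBetween (ω / 2) ω) ω (eth ω) ψ}

end DiracSector

/-!
In polar coordinates, the operator `σ · ∇` is `∂_r + (i σ₃ / r) ∂_θ`, up to swapping the two
components of the result and multiplying them by `e^{∓iθ}`, which does not change the norm. Write
`ψ = (ψ₀, ψ₁)`. With the infinite mass conditions `ψ₁ = ψ₀` at `θ = 0` and `ψ₁ = -e^{iω} ψ₀` at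
`θ = ω`, the angular operator `i σ₃ ∂_θ` on `(0, ω)` has the eigenfunctions `(e^{-iμθ}, e^{iμθ})`
for `μ = μ_k = (ω - π + 2πk) / (2ω)`. Reflecting the first component to
`(-ω, 0)` turns them into a Fourier basis of `(-ω, ω)`, so Parseval's identity
(`tsum_norm_mode_sq`) holds for the pairings `c_k(r)` of `ψ` with these modes. The modes `d_k` of
`σ · ∇ψ` satisfy `d_k = c_k' + (μ_k / r) c_k` (`weakDeriv_radialMode`,
`radialMode_rotatedDirac_ae`). Since `ψ ∈ H¹`, both `d_k` and `c_k'` are in `L²(r dr)`, hence so is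
`c_k / r` if `μ_k ≠ 0`; the cross term in `|d_k|²` is then the integral of the derivative of a
function vanishing at `0` and `∞`, and `μ_k² ∫ |c_k / r|² r dr ≤ ∫ |d_k|² r dr`
(`radial_inequality`). As `ω ≤ 2π`, the smallest `μ_k²` is `μ_0² = (π - ω)² / (4ω²)`
(`freq_zero_sq_le`), and summing over `k` gives the theorem.

Working with the modes means that `ψ` is only ever differentiated weakly against products
`χ(r) E(θ)`. The radial direction uses the smooth approximations of `ψ` on the two halves of the
sector and needs no boundary term (`radialForm_sector`). In the angular direction
(`angularForm_sector`) a partition of unity separates the neighbourhoods of the two edges, where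
the approximations also give the traces, from the interior, where `χ(r) E(θ)` is itself a test
function. In this way no density statement for `H¹` functions on the whole sector is needed.
-/

namespace DiracSector

/-! ### Weak derivatives on the half-line -/

/-- Test functions on the half-line `(0, ∞)`. -/
structure IsTest (χ : ℝ → ℝ) : Prop where
  contDiff : ContDiff ℝ (⊤ : ℕ∞) χ
  compact : HasCompactSupport χ
  pos : tsupport χ ⊆ Ioi 0

theorem IsTest.exists_Icc {χ : ℝ → ℝ} (h : IsTest χ) :
    ∃ l m : ℝ, 0 < l ∧ l < 1 ∧ 1 < m ∧ ∀ r, r ∉ Ioo l m → χ r = 0 := by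
  obtain ⟨m, hm⟩ := h.compact.isCompact.bddAbove
  have hex : ∃ l : ℝ, 0 < l ∧ ∀ r ∈ tsupport χ, l < r := by
    rcases (tsupport χ).eq_empty_or_nonempty with he | hne
    · exact ⟨1, one_pos, by simp [he]⟩
    · obtain ⟨a, ha, hmin⟩ := h.compact.isCompact.exists_isMinOn hne continuous_id.continuousOn
      have ha0 : 0 < a := h.pos ha
      exact ⟨a / 2, by positivity, fun r hr => by have := hmin hr; simp at this; linarith⟩
  obtain ⟨l, hl, hlr⟩ := hex
  refine ⟨min l (1 / 2), max m 1 + 1, by positivity, ?_, ?_, fun r hr => ?_⟩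
  · exact (min_le_right _ _).trans_lt (by norm_num)
  · have := le_max_right m 1; linarith
  · by_contra hne
    have hmem : r ∈ tsupport χ := subset_tsupport _ hne
    refine hr ⟨(min_le_left _ _).trans_lt (hlr r hmem), ?_⟩
    have := hm hmem
    have := le_max_left m 1
    linarith

theorem IsTest.of_Icc {χ : ℝ → ℝ} (h : ContDiff ℝ (⊤ : ℕ∞) χ) {l m : ℝ} (hl : 0 < l)
    (h0 : ∀ r, r ∉ Icc l m → χ r = 0) : IsTest χ := by
  have hs : tsupport χ ⊆ Icc l m :=
    closure_minimal (fun r hr => by by_contra hc; exact hr (h0 r hc)) isClosed_Icc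
  exact ⟨h, isCompact_Icc.of_isClosed_subset (isClosed_tsupport _) hs,
    hs.trans fun r hr => hl.trans_le hr.1⟩

theorem IsTest.sub_mul {φ χ : ℝ → ℝ} (hφ : IsTest φ) (hχ : IsTest χ) (a : ℝ) :
    IsTest (fun r => φ r - a * χ r) := by
  obtain ⟨l, m, hl, -, -, h⟩ := hφ.exists_Icc
  obtain ⟨l', m', hl', -, -, h'⟩ := hχ.exists_Icc
  refine IsTest.of_Icc (hφ.contDiff.sub (contDiff_const.mul hχ.contDiff)) (l := min l l')
    (m := max m m') (by positivity) fun r hr => ?_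
  rw [h, h', mul_zero, sub_zero]
  · exact fun hc => hr ⟨(min_le_right _ _).trans hc.1.le, hc.2.le.trans (le_max_right _ _)⟩
  · exact fun hc => hr ⟨(min_le_left _ _).trans hc.1.le, hc.2.le.trans (le_max_left _ _)⟩

theorem integrableOn_test_mul {u χ : ℝ → ℝ} (hu : LocallyIntegrableOn u (Ioi 0))
    (hχ : Continuous χ) (hc : HasCompactSupport χ) (hs : tsupport χ ⊆ Ioi 0) :
    IntegrableOn (fun r => χ r * u r) (Ioi 0) := by
  have h1 : IntegrableOn u (tsupport χ) := hu.integrableOn_compact_subset hs hc.isCompact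
  have h2 : IntegrableOn (fun r => χ r * u r) (tsupport χ) :=
    h1.continuousOn_mul hχ.continuousOn hc.isCompact
  refine (h2.integrable_of_forall_notMem_eq_zero fun r hr => ?_).integrableOn
  rw [image_eq_zero_of_notMem_tsupport hr, zero_mul]

theorem IsTest.integrableOn_mul {u χ : ℝ → ℝ} (hu : LocallyIntegrableOn u (Ioi 0))
    (hχ : IsTest χ) : IntegrableOn (fun r => χ r * u r) (Ioi 0) :=
  integrableOn_test_mul hu hχ.contDiff.continuous hχ.compact hχ.pos

theorem IsTest.deriv {χ : ℝ → ℝ} (h : IsTest χ) : IsTest (deriv χ) :=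
  ⟨contDiff_infty_iff_deriv.1 h.contDiff |>.2, h.compact.deriv,
    (closure_minimal support_deriv_subset (isClosed_tsupport _)).trans h.pos⟩

/-- A test function with vanishing integral is the derivative of a test function. -/
theorem IsTest.exists_primitive {η : ℝ → ℝ} (h : IsTest η) (h0 : ∫ r in Ioi 0, η r = 0) :
    ∃ χ, IsTest χ ∧ ∀ r, HasDerivAt χ (η r) r := by
  obtain ⟨l, m, hl, hl1, hm1, hz⟩ := h.exists_Icc
  have hcont := h.contDiff.continuous
  have hint : ∫ r in l..m, η r = 0 := by
    rw [intervalIntegral.integral_of_le (by linarith), ← h0]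
    symm
    exact setIntegral_eq_of_subset_of_forall_sdiff_eq_zero measurableSet_Ioi
      (fun r hr => hl.trans hr.1) fun r hr => hz r fun hc => hr.2 ⟨hc.1, hc.2.le⟩
  have hd : ∀ r, HasDerivAt (fun t => ∫ s in l..t, η s) (η r) r := fun r =>
    intervalIntegral.integral_hasDerivAt_right (hcont.intervalIntegrable _ _)
      hcont.aestronglyMeasurable.stronglyMeasurableAtFilter hcont.continuousAt
  refine ⟨fun t => ∫ s in l..t, η s, IsTest.of_Icc ?_ hl (m := m) fun r hr => ?_, hd⟩
  · rw [contDiff_infty_iff_deriv]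
    refine ⟨fun r => (hd r).differentiableAt, ?_⟩
    rw [show _root_.deriv (fun t => ∫ s in l..t, η s) = η from funext fun r => (hd r).deriv]
    exact h.contDiff
  · rcases lt_or_ge r l with hr' | hr'
    · refine intervalIntegral.integral_zero_ae (Eventually.of_forall fun s hs => hz s ?_)
      rw [uIoc_of_ge hr'.le] at hs
      exact fun hc => absurd hc.1 (not_lt.2 hs.2)
    · have hmr : m < r := by by_contra hc; exact hr ⟨hr', not_lt.1 hc⟩
      have h2 : ∫ s in m..r, η s = 0 := by
        refine intervalIntegral.integral_zero_ae (Eventually.of_forall fun s hs => hz s ?_)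
        rw [uIoc_of_le hmr.le] at hs
        exact fun hc => absurd hc.2 (not_lt.2 hs.1.le)
      change ∫ s in l..r, η s = 0
      rw [← intervalIntegral.integral_add_adjacent_intervals (b := m)
        (hcont.intervalIntegrable _ _) (hcont.intervalIntegrable _ _), hint, h2, add_zero]

theorem exists_isTest_integral_eq_one : ∃ χ, IsTest χ ∧ ∫ r in Ioi 0, χ r = 1 := by
  let f : ContDiffBump (2 : ℝ) := ⟨1 / 2, 1, by norm_num, by norm_num⟩
  have h0 : ∀ r, r ∉ Ioo (1 : ℝ) 3 → f.normed volume r = 0 := fun r hr => by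
    have hs := f.support_normed_eq (μ := volume)
    rw [Real.ball_eq_Ioo] at hs
    by_contra hc
    have : r ∈ Ioo (2 - f.rOut) (2 + f.rOut) := hs ▸ hc
    norm_num [f] at this
    exact hr this
  refine ⟨f.normed volume, IsTest.of_Icc f.contDiff_normed one_pos (m := 3)
    fun r hr => h0 r fun hc => hr (Ioo_subset_Icc_self hc), ?_⟩
  rw [setIntegral_eq_integral_of_forall_compl_eq_zero, f.integral_normed]
  exact fun r hr => h0 r fun hc => hr (show (0 : ℝ) < r by linarith [hc.1])

/-- The lemma of du Bois-Reymond: a function with vanishing weak derivative is constant. -/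
theorem exists_ae_eq_const_of_integral_deriv_mul_eq_zero {u : ℝ → ℝ}
    (hu : LocallyIntegrableOn u (Ioi 0))
    (h : ∀ χ, IsTest χ → ∫ r in Ioi 0, deriv χ r * u r = 0) :
    ∃ K, ∀ᵐ r, r ∈ Ioi (0 : ℝ) → u r = K := by
  obtain ⟨χ₀, hχ₀, hone⟩ := exists_isTest_integral_eq_one
  set K := ∫ r in Ioi 0, χ₀ r * u r with hK
  have hone' : LocallyIntegrableOn (fun _ : ℝ => (1 : ℝ)) (Ioi 0) :=
    continuousOn_const.locallyIntegrableOn measurableSet_Ioi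
  have hint : ∀ φ, IsTest φ → IntegrableOn φ (Ioi 0) := fun φ hφ => by
    simpa using hφ.integrableOn_mul hone'
  refine ⟨K, ?_⟩
  have hloc : LocallyIntegrableOn (fun r => u r - K) (Ioi 0) :=
    hu.sub (continuousOn_const.locallyIntegrableOn measurableSet_Ioi)
  have := isOpen_Ioi.ae_eq_zero_of_integral_contDiff_smul_eq_zero hloc fun φ hφ hc hs => ?_
  · filter_upwards [this] with r hr hr0
    exact sub_eq_zero.1 (hr hr0)
  have hT : IsTest φ := ⟨hφ, hc, hs⟩
  set a := ∫ r in Ioi 0, φ r with ha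
  obtain ⟨χ, hχ, hd⟩ := (hT.sub_mul hχ₀ a).exists_primitive (by
    rw [integral_sub (hint _ hT) ((hint _ hχ₀).const_mul a), integral_const_mul, hone]; simp [ha])
  have h1 := h χ hχ
  rw [show deriv χ = _ from funext fun r => (hd r).deriv] at h1
  simp only [_root_.sub_mul, mul_assoc] at h1
  rw [integral_sub (hT.integrableOn_mul hu) ((hχ₀.integrableOn_mul hu).const_mul a),
    integral_const_mul, ← hK] at h1
  rw [← setIntegral_eq_integral_of_forall_compl_eq_zero (s := Ioi (0 : ℝ))]
  · simp only [smul_eq_mul, mul_sub]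
    rw [integral_sub (hT.integrableOn_mul hu) ((hint _ hT).mul_const K), integral_mul_const]
    exact h1
  · intro r hr
    rw [image_eq_zero_of_notMem_tsupport (fun hc => hr (hs hc)), zero_smul]

theorem intervalIntegrable_of_pos {u : ℝ → ℝ} (hu : LocallyIntegrableOn u (Ioi 0)) {a b : ℝ}
    (ha : 0 < a) (hb : 0 < b) : IntervalIntegrable u volume a b := by
  refine (hu.integrableOn_compact_subset (fun r hr => ?_) isCompact_uIcc).intervalIntegrable
  exact (lt_min ha hb).trans_le hr.1

theorem absolutelyContinuousOnInterval_primitive {u : ℝ → ℝ}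
    (hu : LocallyIntegrableOn u (Ioi 0)) {a b : ℝ} (ha : 0 < a) (hb : 0 < b) :
    AbsolutelyContinuousOnInterval (fun r => ∫ s in (1 : ℝ)..r, u s) a b := by
  have hmin : 0 < min a (min b 1) := by positivity
  have hmax : 0 < max a (max b 1) := by positivity
  have hle : min a (min b 1) ≤ max a (max b 1) := (min_le_left _ _).trans (le_max_left _ _)
  refine ((intervalIntegrable_of_pos hu hmin hmax).absolutelyContinuousOnInterval_intervalIntegral
    (c := 1) ?_).mono ?_
  · rw [uIcc_of_le hle]
    exact ⟨by simp, by simp⟩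
  · rw [uIcc_of_le hle]
    exact uIcc_subset_Icc ⟨by simp, by simp⟩ ⟨by simp, by simp⟩

theorem ae_hasDerivAt_primitive {u : ℝ → ℝ} (hu : LocallyIntegrableOn u (Ioi 0)) {a b : ℝ}
    (ha : 0 < a) (ha1 : a ≤ 1) (hb : 1 ≤ b) :
    ∀ᵐ r, r ∈ Icc a b → HasDerivAt (fun r => ∫ s in (1 : ℝ)..r, u s) (u r) r := by
  filter_upwards [(intervalIntegrable_of_pos hu ha (one_pos.trans_le hb)).ae_hasDerivAt_integral]
    with r hr hab
  rw [uIcc_of_le (ha1.trans hb)] at hr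
  exact hr hab 1 ⟨ha1, hb⟩

theorem integral_deriv_mul_primitive {u χ : ℝ → ℝ} (hu : LocallyIntegrableOn u (Ioi 0))
    (hχ : IsTest χ) :
    ∫ r in Ioi 0, deriv χ r * (∫ s in (1 : ℝ)..r, u s) = -∫ r in Ioi 0, χ r * u r := by
  obtain ⟨l, m, hl, hl1, hm1, hz⟩ := hχ.exists_Icc
  have hz' : ∀ r, r ∉ Icc l m → deriv χ r = 0 := fun r hr => by
    by_contra hc
    have h1 : r ∈ tsupport χ := support_deriv_subset hc
    have h2 : tsupport χ ⊆ Icc l m := closure_minimal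
      (fun s hs => by by_contra hc; exact hs (hz s fun h => hc (Ioo_subset_Icc_self h)))
      isClosed_Icc
    exact hr (h2 h1)
  have hlm : l ≤ m := by linarith
  have hsub : ∀ f : ℝ → ℝ, (∀ r, r ∉ Icc l m → f r = 0) →
      ∫ r in Ioi 0, f r = ∫ r in l..m, f r := fun f hf => by
    rw [intervalIntegral.integral_of_le hlm, ← integral_Icc_eq_integral_Ioc]
    exact (setIntegral_eq_of_subset_of_forall_sdiff_eq_zero measurableSet_Ioi
      (fun r hr => hl.trans_le hr.1) fun r hr => hf r hr.2)
  rw [hsub _ fun r hr => by rw [hz' r hr, zero_mul],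
    hsub _ fun r hr => by rw [hz r fun h => hr (Ioo_subset_Icc_self h), zero_mul]]
  have hac : AbsolutelyContinuousOnInterval χ l m := by
    have : ContDiff ℝ 1 χ := hχ.contDiff.of_le (by exact_mod_cast le_top)
    exact this.contDiffOn.absolutelyContinuousOnInterval
  have hp := hac.integral_mul_deriv_eq_deriv_mul
    (absolutelyContinuousOnInterval_primitive hu hl (one_pos.trans hm1))
  rw [hz l (by simp), hz m (by simp), zero_mul, zero_mul, sub_zero, zero_sub] at hp
  rw [eq_neg_iff_add_eq_zero, add_comm, ← eq_neg_iff_add_eq_zero, ← hp]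
  refine intervalIntegral.integral_congr_ae ?_
  filter_upwards [ae_hasDerivAt_primitive hu hl hl1.le hm1.le] with r hr hrm
  rw [uIoc_of_le hlm] at hrm
  rw [(hr (Ioc_subset_Icc_self hrm)).deriv]

/-- A locally integrable function with locally integrable weak derivative `u₁` is, up to a null
set, a primitive of `u₁`. -/
theorem exists_ae_eq_primitive {u u₁ : ℝ → ℝ} (hu : LocallyIntegrableOn u (Ioi 0))
    (hu₁ : LocallyIntegrableOn u₁ (Ioi 0))
    (h : ∀ χ, IsTest χ → ∫ r in Ioi 0, deriv χ r * u r = -∫ r in Ioi 0, χ r * u₁ r) :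
    ∃ K, ∀ᵐ r, r ∈ Ioi (0 : ℝ) → u r = K + ∫ s in (1 : ℝ)..r, u₁ s := by
  have hcont : ContinuousOn (fun r => ∫ s in (1 : ℝ)..r, u₁ s) (Ioi 0) := fun r hr => by
    have h0 : (0 : ℝ) < r := hr
    have := (absolutelyContinuousOnInterval_primitive hu₁ (half_pos h0)
      (show (0 : ℝ) < 2 * r by positivity)).continuousOn
    rw [uIcc_of_le (by linarith)] at this
    exact (this.continuousAt (Icc_mem_nhds (by linarith) (by linarith))).continuousWithinAt
  have hp := hcont.locallyIntegrableOn (μ := volume) measurableSet_Ioi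
  obtain ⟨K, hK⟩ := exists_ae_eq_const_of_integral_deriv_mul_eq_zero (hu.sub hp) fun χ hχ => by
    simp only [Pi.sub_apply, mul_sub]
    rw [integral_sub (hχ.deriv.integrableOn_mul hu) (hχ.deriv.integrableOn_mul hp), h χ hχ,
      integral_deriv_mul_primitive hu₁ hχ, sub_self]
  refine ⟨K, hK.mono fun r hr h0 => ?_⟩
  have := hr h0
  simp only [Pi.sub_apply] at this
  linarith

/-! ### The radial inequality -/

theorem locallyIntegrableOn_of_norm_le {F G : Type*} [NormedAddCommGroup F]
    [NormedAddCommGroup G] {f : ℝ → F} {g : ℝ → G} {s : Set ℝ} (hg : LocallyIntegrableOn g s)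
    (hm : AEStronglyMeasurable f (volume.restrict s))
    (h : ∀ᵐ r ∂volume.restrict s, ‖f r‖ ≤ ‖g r‖) : LocallyIntegrableOn f s := fun x hx => by
  obtain ⟨t, ht, hi⟩ := hg x hx
  have hle : volume.restrict (t ∩ s) ≤ volume.restrict s :=
    Measure.restrict_mono inter_subset_right le_rfl
  exact ⟨t ∩ s, inter_mem ht self_mem_nhdsWithin, Integrable.mono
    (hi.mono_set inter_subset_left) (hm.mono_measure hle) (ae_mono hle h)⟩

theorem locallyIntegrableOn_of_sq_div {u : ℝ → ℝ}
    (hm : AEStronglyMeasurable u (volume.restrict (Ioi 0)))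
    (hu : IntegrableOn (fun r => u r ^ 2 / r) (Ioi 0)) : LocallyIntegrableOn u (Ioi 0) := by
  have h1 : LocallyIntegrableOn (fun r : ℝ => u r ^ 2 / r + r) (Ioi 0) :=
    hu.locallyIntegrableOn.add (continuousOn_id.locallyIntegrableOn measurableSet_Ioi)
  refine locallyIntegrableOn_of_norm_le h1 hm ?_
  filter_upwards [ae_restrict_mem measurableSet_Ioi] with r hr
  have h0 : (0 : ℝ) < r := hr
  rw [Real.norm_eq_abs, Real.norm_of_nonneg (by positivity)]
  have h2 : u r ^ 2 / r + r = (u r ^ 2 + r ^ 2) / r := by field_simp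
  rw [h2, le_div_iff₀ h0]
  nlinarith [sq_nonneg (|u r| - r), sq_abs (u r), abs_nonneg (u r), sq_nonneg (|u r|)]

theorem locallyIntegrableOn_of_mul_sq {u : ℝ → ℝ}
    (hm : AEStronglyMeasurable u (volume.restrict (Ioi 0)))
    (hu : IntegrableOn (fun r => r * u r ^ 2) (Ioi 0)) : LocallyIntegrableOn u (Ioi 0) := by
  have h1 : LocallyIntegrableOn (fun r : ℝ => r * u r ^ 2 + r⁻¹) (Ioi 0) :=
    hu.locallyIntegrableOn.add
      ((continuousOn_id.inv₀ fun r hr => (ne_of_gt hr)).locallyIntegrableOn measurableSet_Ioi)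
  refine locallyIntegrableOn_of_norm_le h1 hm ?_
  filter_upwards [ae_restrict_mem measurableSet_Ioi] with r hr
  have h0 : (0 : ℝ) < r := hr
  rw [Real.norm_eq_abs, Real.norm_of_nonneg (by positivity)]
  have h2 : r * u r ^ 2 + r⁻¹ = ((r * u r) ^ 2 + 1) / r := by field_simp
  rw [h2, le_div_iff₀ h0]
  rw [mul_pow, ← sq_abs (u r)]
  nlinarith [sq_nonneg (|u r| * r - 1), mul_nonneg (abs_nonneg (u r)) h0.le]

theorem integrableOn_mul_of_sq {u u₁ : ℝ → ℝ}
    (hm : AEStronglyMeasurable u (volume.restrict (Ioi 0)))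
    (hu : IntegrableOn (fun r => u r ^ 2 / r) (Ioi 0))
    (hm₁ : AEStronglyMeasurable u₁ (volume.restrict (Ioi 0)))
    (hu₁ : IntegrableOn (fun r => r * u₁ r ^ 2) (Ioi 0)) :
    IntegrableOn (fun r => u r * u₁ r) (Ioi 0) := by
  refine (hu.add hu₁).mono' (hm.mul hm₁) ?_
  filter_upwards [ae_restrict_mem measurableSet_Ioi] with r hr
  have h0 : (0 : ℝ) < r := hr
  rw [Real.norm_eq_abs, abs_mul]
  have h2 : u r ^ 2 / r + r * u₁ r ^ 2 = (u r ^ 2 + (r * u₁ r) ^ 2) / r := by field_simp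
  simp only [Pi.add_apply]
  rw [h2, le_div_iff₀ h0]
  nlinarith [sq_nonneg (|u r| - r * |u₁ r|), sq_abs (u r), sq_abs (u₁ r), abs_nonneg (u r),
    mul_nonneg (abs_nonneg (u r)) (mul_nonneg h0.le (abs_nonneg (u₁ r))), mul_pow r (u₁ r) 2,
    mul_pow r |u₁ r| 2]

theorem eq_zero_of_tendsto_atTop {g : ℝ → ℝ} {L : ℝ} (hg : ∀ r, 0 ≤ g r)
    (hint : IntegrableOn (fun r => g r / r) (Ioi 0)) (hL : Tendsto g atTop (𝓝 L)) : L = 0 := by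
  by_contra hne
  have hpos : 0 < L := lt_of_le_of_ne (ge_of_tendsto' hL hg) (Ne.symm hne)
  obtain ⟨B, hB⟩ := eventually_atTop.1 (hL.eventually (lt_mem_nhds (half_lt_self hpos)))
  refine not_integrableOn_Ioi_inv (a := max B 1) ?_
  have h1 : IntegrableOn (fun r => 2 / L * (g r / r)) (Ioi (max B 1)) :=
    (hint.mono_set (Ioi_subset_Ioi (zero_le_one.trans (le_max_right _ _)))).const_mul _
  refine h1.mono' (by fun_prop) ?_
  filter_upwards [ae_restrict_mem measurableSet_Ioi] with r hr
  have hr1 : 1 < r := (le_max_right _ _).trans_lt hr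
  have hrB := hB r ((le_max_left _ _).trans hr.le)
  have h0 : 0 < r := by linarith
  rw [Real.norm_of_nonneg (by positivity), ← mul_div_assoc, inv_eq_one_div]
  gcongr
  rw [div_mul_eq_mul_div, le_div_iff₀ hpos]
  linarith

theorem eq_zero_of_tendsto_zero {g : ℝ → ℝ} {L : ℝ} (hg : ∀ r, 0 ≤ g r)
    (hint : IntegrableOn (fun r => g r / r) (Ioi 0)) (hL : Tendsto g (𝓝[>] 0) (𝓝 L)) :
    L = 0 := by
  by_contra hne
  have hpos : 0 < L := lt_of_le_of_ne (ge_of_tendsto' hL hg) (Ne.symm hne)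
  obtain ⟨δ, hδ, hδL⟩ := mem_nhdsGT_iff_exists_Ioc_subset.1
    (hL.eventually (lt_mem_nhds (half_lt_self hpos)))
  have hδ0 : (0 : ℝ) < δ := hδ
  have h1 : IntegrableOn (fun r => 2 / L * (g r / r)) (Ioc 0 δ) :=
    (hint.mono_set Ioc_subset_Ioi_self).const_mul _
  have h2 : IntegrableOn (fun r : ℝ => r⁻¹) (Ioc 0 δ) := by
    refine h1.mono' (by fun_prop) ?_
    filter_upwards [ae_restrict_mem measurableSet_Ioc] with r hr
    have h0 : 0 < r := hr.1
    have hrB : L / 2 < g r := hδL hr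
    rw [Real.norm_of_nonneg (by positivity), ← mul_div_assoc, inv_eq_one_div]
    gcongr
    rw [div_mul_eq_mul_div, le_div_iff₀ hpos]
    linarith
  have h3 := (intervalIntegrable_iff_integrableOn_Ioc_of_le hδ0.le).2 h2
  rw [intervalIntegrable_inv_iff] at h3
  rcases h3 with h3 | h3
  · exact hδ0.ne h3
  · exact h3 (by simp)

/-- If `u ∈ L²(dr/r)` has weak derivative `u₁ ∈ L²(r dr)`, then `u²` vanishes at both ends of the
half-line and `∫ u u₁ dr = 0`. -/
theorem integral_mul_weakDeriv_eq_zero {u u₁ : ℝ → ℝ}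
    (hm : AEStronglyMeasurable u (volume.restrict (Ioi 0)))
    (hu : IntegrableOn (fun r => u r ^ 2 / r) (Ioi 0))
    (hm₁ : AEStronglyMeasurable u₁ (volume.restrict (Ioi 0)))
    (hu₁ : IntegrableOn (fun r => r * u₁ r ^ 2) (Ioi 0))
    (h : ∀ χ, IsTest χ → ∫ r in Ioi 0, deriv χ r * u r = -∫ r in Ioi 0, χ r * u₁ r) :
    ∫ r in Ioi 0, u r * u₁ r = 0 := by
  have hloc := locallyIntegrableOn_of_mul_sq hm₁ hu₁
  obtain ⟨K, hK⟩ := exists_ae_eq_primitive (locallyIntegrableOn_of_sq_div hm hu) hloc h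
  set C : ℝ → ℝ := fun r => K + ∫ s in (1 : ℝ)..r, u₁ s with hC
  have hf := integrableOn_mul_of_sq hm hu hm₁ hu₁
  have hCint : IntegrableOn (fun r => C r ^ 2 / r) (Ioi 0) := by
    refine hu.congr ?_
    filter_upwards [ae_restrict_mem measurableSet_Ioi, ae_restrict_of_ae hK] with r hr hr2
    simp only [hC, hr2 hr]
  have hFTC : ∀ a b : ℝ, 0 < a → a ≤ 1 → 1 ≤ b →
      C b ^ 2 - C a ^ 2 = 2 * ∫ r in a..b, u r * u₁ r := fun a b ha ha1 hb => by
    have hac : AbsolutelyContinuousOnInterval C a b := by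
      have hc : AbsolutelyContinuousOnInterval (fun _ : ℝ => K) a b :=
        (contDiff_const (n := 1)).contDiffOn.absolutelyContinuousOnInterval
      exact hc.add (absolutelyContinuousOnInterval_primitive hloc ha (one_pos.trans_le hb))
    rw [pow_two, pow_two, ← hac.integral_deriv_mul_eq_sub hac,
      ← intervalIntegral.integral_const_mul]
    refine intervalIntegral.integral_congr_ae ?_
    filter_upwards [ae_hasDerivAt_primitive hloc ha ha1 hb, hK] with r hr hr2 hrm
    rw [uIoc_of_le (ha1.trans hb)] at hrm
    rw [((hr (Ioc_subset_Icc_self hrm)).const_add K).deriv, hr2 (ha.trans hrm.1)]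
    ring
  have htop : Tendsto (fun b => C b ^ 2) atTop
      (𝓝 (C 1 ^ 2 + 2 * ∫ r in Ioi 1, u r * u₁ r)) := by
    have h1 := (intervalIntegral_tendsto_integral_Ioi 1
      (hf.mono_set (Ioi_subset_Ioi zero_le_one)) tendsto_id).const_mul 2 |>.const_add (C 1 ^ 2)
    refine h1.congr' ?_
    filter_upwards [eventually_ge_atTop 1] with b hb
    have := hFTC 1 b one_pos le_rfl hb
    simp only [id]
    linarith
  have hzero : Tendsto (fun a => C a ^ 2) (𝓝[>] 0)
      (𝓝 (C 1 ^ 2 - 2 * ∫ r in (0 : ℝ)..1, u r * u₁ r)) := by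
    have hI : IntegrableOn (fun r => u r * u₁ r) (uIcc 0 1) := by
      rw [uIcc_of_le zero_le_one, integrableOn_Icc_iff_integrableOn_Ioc]
      exact hf.mono_set Ioc_subset_Ioi_self
    have h1 := intervalIntegral.continuousOn_primitive_interval_left hI 0 (by simp)
    have h2 : Tendsto (fun a => ∫ r in a..1, u r * u₁ r) (𝓝[>] 0)
        (𝓝 (∫ r in (0 : ℝ)..1, u r * u₁ r)) := by
      refine h1.tendsto.mono_left ?_
      rw [uIcc_of_le zero_le_one, ← nhdsWithin_Ioc_eq_nhdsGT (zero_lt_one (α := ℝ))]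
      exact nhdsWithin_mono _ Ioc_subset_Icc_self
    refine ((h2.const_mul 2).const_sub (C 1 ^ 2)).congr' ?_
    filter_upwards [Ioc_mem_nhdsGT (zero_lt_one (α := ℝ))] with a ha
    have := hFTC a 1 ha.1 ha.2 le_rfl
    linarith
  have e1 := eq_zero_of_tendsto_atTop (fun r => sq_nonneg (C r)) hCint htop
  have e2 := eq_zero_of_tendsto_zero (fun r => sq_nonneg (C r)) hCint hzero
  rw [intervalIntegral.integral_of_le zero_le_one] at e2
  rw [← Ioc_union_Ioi_eq_Ioi zero_le_one, setIntegral_union (Ioc_disjoint_Ioi le_rfl)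
    measurableSet_Ioi (hf.mono_set Ioc_subset_Ioi_self)
    (hf.mono_set (Ioi_subset_Ioi zero_le_one))]
  linarith

/-- The measure `r dr` on the half-line `(0, ∞)`. -/
noncomputable def radialMeasure : Measure ℝ :=
  (volume.restrict (Ioi (0 : ℝ))).withDensity ENNReal.ofReal

instance : SFinite radialMeasure := by unfold radialMeasure; infer_instance

theorem radialMeasure_absolutelyContinuous : radialMeasure ≪ volume.restrict (Ioi (0 : ℝ)) :=
  withDensity_absolutelyContinuous _ _

theorem absolutelyContinuous_radialMeasure : volume.restrict (Ioi (0 : ℝ)) ≪ radialMeasure := by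
  refine withDensity_absolutelyContinuous' ENNReal.measurable_ofReal.aemeasurable ?_
  filter_upwards [ae_restrict_mem measurableSet_Ioi] with r hr
  exact (ENNReal.ofReal_pos.2 hr).ne'

theorem ae_radialMeasure_pos : ∀ᵐ r ∂radialMeasure, 0 < r :=
  radialMeasure_absolutelyContinuous.ae_le (ae_restrict_mem measurableSet_Ioi)

theorem integral_radialMeasure {F : Type*} [NormedAddCommGroup F] [NormedSpace ℝ F] (f : ℝ → F) :
    ∫ r, f r ∂radialMeasure = ∫ r in Ioi 0, r • f r := by
  rw [radialMeasure, integral_withDensity_eq_integral_toReal_smul ENNReal.measurable_ofReal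
    (by simp)]
  refine setIntegral_congr_fun measurableSet_Ioi fun r hr => ?_
  simp only [ENNReal.toReal_ofReal (le_of_lt hr)]

theorem integrable_radialMeasure_iff {F : Type*} [NormedAddCommGroup F] [NormedSpace ℝ F]
    {f : ℝ → F} : Integrable f radialMeasure ↔ IntegrableOn (fun r => r • f r) (Ioi 0) := by
  rw [radialMeasure, integrable_withDensity_iff_integrable_smul' ENNReal.measurable_ofReal
    (by simp)]
  refine integrable_congr ?_
  filter_upwards [ae_restrict_mem measurableSet_Ioi] with r hr
  simp only [ENNReal.toReal_ofReal (le_of_lt hr)]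

/-- The radial Hardy inequality: if `c` has weak derivative `c₁` on `(0, ∞)` and
`d = c₁ + (μ / r) c`, all in `L²(r dr)`, then `μ² ∫ |c|² / r² ≤ ∫ |d|²`. The point is that
`(μ / r) c = d - c₁` forces `c / r ∈ L²(r dr)`, so that the cross term integrates to zero. -/
theorem radial_inequality {c c₁ d : ℝ → ℂ} {μ : ℝ}
    (hcm : AEStronglyMeasurable c radialMeasure) (hc₁ : MemLp c₁ 2 radialMeasure)
    (hd : MemLp d 2 radialMeasure)
    (hode : ∀ᵐ r ∂radialMeasure, d r = c₁ r + ((μ / r : ℝ) : ℂ) * c r)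
    (hw : ∀ χ, IsTest χ → ∫ r in Ioi 0, deriv χ r • c r = -∫ r in Ioi 0, χ r • c₁ r) :
    ENNReal.ofReal (μ ^ 2) * ∫⁻ r, ENNReal.ofReal (‖c r‖ ^ 2 / r ^ 2) ∂radialMeasure ≤
      ∫⁻ r, ENNReal.ofReal (‖d r‖ ^ 2) ∂radialMeasure := by
  rcases eq_or_ne μ 0 with rfl | hμ
  · simp
  have hcd : MemLp (fun r => (r⁻¹ : ℝ) • c r) 2 radialMeasure := by
    refine ((hd.sub hc₁).const_smul (μ⁻¹)).ae_eq ?_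
    filter_upwards [hode, ae_radialMeasure_pos] with r hr h0
    simp only [Pi.smul_apply, Pi.sub_apply, hr, add_sub_cancel_left, Complex.real_smul]
    push_cast
    have : (μ : ℂ) ≠ 0 := by exact_mod_cast hμ
    field_simp
  have hac := absolutelyContinuous_radialMeasure
  have hcm' := hcm.mono_ac hac
  have hc₁m' := hc₁.1.mono_ac hac
  have hcsq : IntegrableOn (fun r => ‖c r‖ ^ 2 / r) (Ioi 0) := by
    have := integrable_radialMeasure_iff.1 ((memLp_two_iff_integrable_sq_norm hcd.1).1 hcd)
    refine (integrableOn_congr_fun (fun r hr => ?_) measurableSet_Ioi).1 this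
    have h0 : (0 : ℝ) < r := hr
    simp only [norm_smul, smul_eq_mul, norm_inv, Real.norm_of_nonneg h0.le]
    field_simp
  have hc₁sq : IntegrableOn (fun r => r * ‖c₁ r‖ ^ 2) (Ioi 0) :=
    integrable_radialMeasure_iff.1 ((memLp_two_iff_integrable_sq_norm hc₁.1).1 hc₁)
  have hdsq : Integrable (fun r => ‖d r‖ ^ 2) radialMeasure :=
    (memLp_two_iff_integrable_sq_norm hd.1).1 hd
  -- Each real component of `c` satisfies the hypotheses of the real lemma.
  have hcomp : ∀ T : ℂ →L[ℝ] ℝ, (∀ z, |T z| ≤ ‖z‖) →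
      IntegrableOn (fun r => T (c r) * T (c₁ r)) (Ioi 0) ∧
        ∫ r in Ioi 0, T (c r) * T (c₁ r) = 0 := fun T hT => by
    have m : AEStronglyMeasurable (fun r => T (c r)) (volume.restrict (Ioi 0)) :=
      T.continuous.comp_aestronglyMeasurable hcm'
    have m₁ : AEStronglyMeasurable (fun r => T (c₁ r)) (volume.restrict (Ioi 0)) :=
      T.continuous.comp_aestronglyMeasurable hc₁m'
    have hTsq : ∀ z, (T z) ^ 2 ≤ ‖z‖ ^ 2 := fun z => sq_le_sq' (abs_le.1 (hT z)).1 (abs_le.1 (hT z)).2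
    have i : IntegrableOn (fun r => T (c r) ^ 2 / r) (Ioi 0) := by
      refine hcsq.mono' ((m.pow 2).div₀ (by fun_prop)) ?_
      filter_upwards [ae_restrict_mem measurableSet_Ioi] with r hr
      have h0 : (0 : ℝ) < r := hr
      rw [Real.norm_of_nonneg (by positivity)]
      exact div_le_div_of_nonneg_right (hTsq _) h0.le
    have i₁ : IntegrableOn (fun r => r * T (c₁ r) ^ 2) (Ioi 0) := by
      refine hc₁sq.mono' (AEStronglyMeasurable.mul (by fun_prop) (m₁.pow 2)) ?_
      filter_upwards [ae_restrict_mem measurableSet_Ioi] with r hr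
      have h0 : (0 : ℝ) < r := hr
      rw [Real.norm_of_nonneg (by positivity)]
      exact mul_le_mul_of_nonneg_left (hTsq _) h0.le
    refine ⟨integrableOn_mul_of_sq m i m₁ i₁, integral_mul_weakDeriv_eq_zero m i m₁ i₁ ?_⟩
    intro χ hχ
    have hlc : LocallyIntegrableOn c (Ioi 0) := by
      have := locallyIntegrableOn_of_sq_div hcm'.norm hcsq
      exact locallyIntegrableOn_of_norm_le this hcm' (Eventually.of_forall fun r => by simp)
    have hlc₁ : LocallyIntegrableOn c₁ (Ioi 0) := by
      have := locallyIntegrableOn_of_mul_sq hc₁m'.norm hc₁sq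
      exact locallyIntegrableOn_of_norm_le this hc₁m' (Eventually.of_forall fun r => by simp)
    have hint : ∀ {f : ℝ → ℂ} {χ : ℝ → ℝ}, LocallyIntegrableOn f (Ioi 0) →
        AEStronglyMeasurable f (volume.restrict (Ioi 0)) → IsTest χ →
        IntegrableOn (fun r => χ r • f r) (Ioi 0) := fun {f χ} hf hfm hχ => by
      have := hχ.integrableOn_mul (u := fun r => ‖f r‖) hf.norm
      exact Integrable.mono this (AEStronglyMeasurable.smul
        hχ.contDiff.continuous.aestronglyMeasurable hfm)
        (Eventually.of_forall fun r => by rw [norm_smul, norm_mul, norm_norm])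
    have e := congrArg T (hw χ hχ)
    rw [map_neg, ← T.integral_comp_comm (hint hlc hcm' hχ.deriv),
      ← T.integral_comp_comm (hint hlc₁ hc₁m' hχ)] at e
    simpa only [map_smul, smul_eq_mul] using e
  obtain ⟨ire, hre⟩ := hcomp Complex.reCLM fun z => Complex.abs_re_le_norm z
  obtain ⟨iim, him⟩ := hcomp Complex.imCLM fun z => Complex.abs_im_le_norm z
  have key : ∫ r, ‖d r‖ ^ 2 ∂radialMeasure =
      (∫ r in Ioi 0, r * ‖c₁ r‖ ^ 2) + μ ^ 2 * ∫ r in Ioi 0, ‖c r‖ ^ 2 / r := by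
    have hsum : ∫ r, ‖d r‖ ^ 2 ∂radialMeasure = ∫ r in Ioi 0, (r * ‖c₁ r‖ ^ 2 +
        μ ^ 2 * (‖c r‖ ^ 2 / r)) + 2 * μ * (Complex.reCLM (c r) * Complex.reCLM (c₁ r) +
          Complex.imCLM (c r) * Complex.imCLM (c₁ r)) := by
      rw [integral_radialMeasure]
      refine integral_congr_ae ?_
      filter_upwards [hac.ae_le hode, ae_restrict_mem measurableSet_Ioi] with r hr hr0
      have h0 : (0 : ℝ) < r := hr0
      simp only [hr, Complex.sq_norm, Complex.normSq_apply, smul_eq_mul, Complex.reCLM_apply,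
        Complex.imCLM_apply, Complex.add_re, Complex.add_im, Complex.re_ofReal_mul,
        Complex.im_ofReal_mul]
      field_simp
      ring
    rw [hsum, integral_add, integral_add, integral_const_mul, integral_const_mul, integral_add ire
      iim, hre, him]
    · ring
    · exact hc₁sq
    · exact hcsq.const_mul _
    · exact hc₁sq.add (hcsq.const_mul _)
    · exact (ire.add iim).const_mul _
  have hcsq' : Integrable (fun r => ‖c r‖ ^ 2 / r ^ 2) radialMeasure := by
    rw [integrable_radialMeasure_iff]
    refine (integrableOn_congr_fun (fun r hr => ?_) measurableSet_Ioi).1 hcsq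
    have h0 : (0 : ℝ) < r := hr
    simp only [smul_eq_mul]
    field_simp
  rw [← ofReal_integral_eq_lintegral_ofReal hcsq' (Eventually.of_forall fun r => by positivity),
    ← ofReal_integral_eq_lintegral_ofReal hdsq (Eventually.of_forall fun r => by positivity),
    ← ENNReal.ofReal_mul (sq_nonneg μ)]
  refine ENNReal.ofReal_le_ofReal ?_
  rw [key]
  have h1 : ∫ r, ‖c r‖ ^ 2 / r ^ 2 ∂radialMeasure = ∫ r in Ioi 0, ‖c r‖ ^ 2 / r := by
    rw [integral_radialMeasure]
    refine setIntegral_congr_fun measurableSet_Ioi fun r hr => ?_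
    have h0 : (0 : ℝ) < r := hr
    simp only [smul_eq_mul]
    field_simp
  rw [h1]
  have : 0 ≤ ∫ r in Ioi 0, r * ‖c₁ r‖ ^ 2 :=
    setIntegral_nonneg measurableSet_Ioi fun r hr => mul_nonneg (le_of_lt hr) (sq_nonneg _)
  linarith

/-! ### Angular modes and Parseval's identity -/

/-- Lebesgue measure on the interval `(α, β)` of angles. -/
noncomputable abbrev arc (α β : ℝ) : Measure ℝ := volume.restrict (Ioo α β)

/-- The angular frequencies `μ_k = (ω - π + 2πk) / (2ω)`: the eigenvalues of `i σ₃ ∂_θ` on `(0, ω)`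
with the infinite mass boundary conditions. -/
noncomputable def freq (ω : ℝ) (k : ℤ) : ℝ := (ω - Real.pi + 2 * Real.pi * k) / (2 * ω)

/-- The angular factor `e^{iμθ}`. -/
noncomputable def phase (μ θ : ℝ) : ℂ := Complex.exp (Complex.I * (μ * θ : ℝ))

/-- The pairing of `(f₀, f₁)` with the angular mode `(e^{-iμθ}, e^{iμθ})` on `(0, ω)`. -/
noncomputable def mode (ω μ : ℝ) (f₀ f₁ : ℝ → ℂ) : ℂ :=
  ∫ θ, (phase μ θ * f₀ θ + phase (-μ) θ * f₁ θ) ∂(arc 0 ω)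

theorem norm_phase (μ θ : ℝ) : ‖phase μ θ‖ = 1 := by
  rw [phase, mul_comm, Complex.norm_exp_ofReal_mul_I]

theorem continuous_phase (μ : ℝ) : Continuous (phase μ) := by
  unfold phase; fun_prop

theorem memLp_phase_mul {α β μ : ℝ} {f : ℝ → ℂ} (hf : MemLp f 2 (arc α β)) :
    MemLp (fun θ => phase μ θ * f θ) 2 (arc α β) :=
  hf.of_le ((continuous_phase μ).aestronglyMeasurable.mul hf.1)
    (Eventually.of_forall fun θ => by rw [norm_mul, norm_phase, one_mul])

theorem MemLp.integrable_arc {α β : ℝ} {f : ℝ → ℂ} (hf : MemLp f 2 (arc α β)) :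
    Integrable f (arc α β) := hf.integrable (by norm_num)

/-- The function on `(-ω, ω)` obtained by reflecting the first component, multiplied by a phase that
makes the lowest frequency zero. -/
noncomputable def unfolded (ω : ℝ) (f₀ f₁ : ℝ → ℂ) : ℝ → ℂ :=
  (Ioi (0 : ℝ)).piecewise (fun θ => phase (-freq ω 0) θ * f₁ θ)
    (fun θ => phase (-freq ω 0) θ * f₀ (-θ))

theorem map_neg_arc (ω : ℝ) : MeasurePreserving (fun θ : ℝ => -θ)
    (volume.restrict (Ioo (-ω) 0)) (arc 0 ω) := by
  have := (Measure.measurePreserving_neg (volume : Measure ℝ)).restrict_preimage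
    (measurableSet_Ioo (a := (0 : ℝ)) (b := ω))
  simpa using this

theorem memLp_unfolded {ω : ℝ} {f₀ f₁ : ℝ → ℂ} (hω : 0 < ω)
    (h₀ : MemLp f₀ 2 (arc 0 ω)) (h₁ : MemLp f₁ 2 (arc 0 ω)) :
    MemLp (unfolded ω f₀ f₁) 2 (volume.restrict (Ioc (-ω) ω)) := by
  refine MemLp.piecewise measurableSet_Ioi ?_ ?_
  · rw [Measure.restrict_restrict measurableSet_Ioi,
      show Ioi 0 ∩ Ioc (-ω) ω = Ioc 0 ω by ext; simp; grind, ← restrict_Ioo_eq_restrict_Ioc]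
    exact memLp_phase_mul h₁
  · rw [Measure.restrict_restrict measurableSet_Ioi.compl,
      show (Ioi 0)ᶜ ∩ Ioc (-ω) ω = Ioc (-ω) 0 by ext; simp; grind,
      ← restrict_Ioo_eq_restrict_Ioc]
    exact memLp_phase_mul (h₀.comp_measurePreserving (map_neg_arc ω))

theorem integral_split_neg {ω : ℝ} (hω : 0 < ω) {F : Type*} [NormedAddCommGroup F]
    [NormedSpace ℝ F] {g : ℝ → F} (hg : IntegrableOn g (Ioc (-ω) ω)) :
    ∫ θ in (-ω)..ω, g θ = ∫ θ, g (-θ) ∂(arc 0 ω) + ∫ θ, g θ ∂(arc 0 ω) := by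
  have hi := (intervalIntegrable_iff_integrableOn_Ioc_of_le (by linarith)).2 hg
  have h0 : (0 : ℝ) ∈ uIcc (-ω) ω := by rw [uIcc_of_le (by linarith)]; constructor <;> linarith
  rw [← intervalIntegral.integral_add_adjacent_intervals (b := 0)
    (hi.mono_set (uIcc_subset_uIcc_left h0)) (hi.mono_set (uIcc_subset_uIcc_right h0)),
    arc, ← integral_Ioc_eq_integral_Ioo, ← integral_Ioc_eq_integral_Ioo,
    ← intervalIntegral.integral_of_le hω.le, ← intervalIntegral.integral_of_le hω.le,
    intervalIntegral.integral_comp_neg, neg_zero]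

theorem phase_mul_phase (μ ν θ : ℝ) : phase μ θ * phase ν θ = phase (μ + ν) θ := by
  rw [phase, phase, phase, ← Complex.exp_add]
  congr 1
  push_cast
  ring

theorem phase_neg_right (μ θ : ℝ) : phase μ (-θ) = phase (-μ) θ := by
  rw [phase, phase]
  congr 2
  push_cast
  ring

theorem integrable_mode {ω μ : ℝ} {f₀ f₁ : ℝ → ℂ} (h₀ : MemLp f₀ 2 (arc 0 ω))
    (h₁ : MemLp f₁ 2 (arc 0 ω)) :
    Integrable (fun θ => phase μ θ * f₀ θ + phase (-μ) θ * f₁ θ) (arc 0 ω) :=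
  MemLp.integrable_arc ((memLp_phase_mul h₀).add (memLp_phase_mul h₁))

theorem fourierCoeffOn_unfolded {ω : ℝ} (hω : 0 < ω) {f₀ f₁ : ℝ → ℂ}
    (h₀ : MemLp f₀ 2 (arc 0 ω)) (h₁ : MemLp f₁ 2 (arc 0 ω)) (k : ℤ) :
    fourierCoeffOn (show -ω < ω by linarith) (unfolded ω f₀ f₁) k =
      (1 / (2 * ω) : ℝ) • mode ω (freq ω k) f₀ f₁ := by
  have hper : ∀ θ : ℝ, fourier (-k) (θ : AddCircle (ω - -ω)) * phase (-freq ω 0) θ =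
      phase (-freq ω k) θ := fun θ => by
    rw [fourier_coe_apply, phase, phase, ← Complex.exp_add, freq, freq]
    congr 1
    have : (ω : ℂ) ≠ 0 := by exact_mod_cast hω.ne'
    push_cast
    have h2 : (ω : ℂ) - -ω = 2 * ω := by ring
    rw [h2]
    field_simp
    ring
  have hmem : MemLp (fun θ : ℝ => fourier (-k) (θ : AddCircle (ω - -ω)) • unfolded ω f₀ f₁ θ) 2
      (volume.restrict (Ioc (-ω) ω)) := by
    have hu := memLp_unfolded hω h₀ h₁
    have hn : ∀ θ : ℝ, ‖fourier (-k) (θ : AddCircle (ω - -ω))‖ = 1 := fun θ =>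
      Circle.norm_coe _
    have hc : Continuous fun θ : ℝ => fourier (-k) (θ : AddCircle (ω - -ω)) :=
      (fourier (-k)).continuous.comp (AddCircle.continuous_mk' _)
    exact hu.of_le (hc.aestronglyMeasurable.smul hu.1)
      (Eventually.of_forall fun θ => by rw [norm_smul, hn, one_mul])
  rw [fourierCoeffOn_eq_integral, integral_split_neg hω (hmem.integrable (by norm_num)), mode,
    show ω - -ω = 2 * ω by ring]
  congr 1
  rw [integral_add (MemLp.integrable_arc (memLp_phase_mul h₀))
    (MemLp.integrable_arc (memLp_phase_mul h₁))]
  congr 1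
  · refine setIntegral_congr_fun measurableSet_Ioo fun θ hθ => ?_
    have hn : -θ ∉ Ioi (0 : ℝ) := by simpa using hθ.1.le
    have := hper (-θ)
    simp only [unfolded, piecewise_eq_of_notMem _ _ _ hn, smul_eq_mul, neg_neg]
    rw [← mul_assoc]
    rw [show ω - -ω = 2 * ω by ring] at this
    rw [this, phase_neg_right, neg_neg]
  · refine setIntegral_congr_fun measurableSet_Ioo fun θ hθ => ?_
    have := hper θ
    simp only [unfolded, piecewise_eq_of_mem _ _ _ (show θ ∈ Ioi (0 : ℝ) from hθ.1), smul_eq_mul]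
    rw [← mul_assoc]
    rw [show ω - -ω = 2 * ω by ring] at this
    rw [this]

/-- Parseval's identity for the angular modes. -/
theorem tsum_norm_mode_sq {ω : ℝ} (hω : 0 < ω) {f₀ f₁ : ℝ → ℂ}
    (h₀ : MemLp f₀ 2 (arc 0 ω)) (h₁ : MemLp f₁ 2 (arc 0 ω)) :
    ∑' k : ℤ, ENNReal.ofReal (‖mode ω (freq ω k) f₀ f₁‖ ^ 2) =
      ENNReal.ofReal (2 * ω) * ∫⁻ θ, ENNReal.ofReal (‖f₀ θ‖ ^ 2 + ‖f₁ θ‖ ^ 2) ∂(arc 0 ω) := by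
  have hP := hasSum_sq_fourierCoeffOn (show -ω < ω by linarith) (memLp_unfolded hω h₀ h₁)
  have s₀ : Integrable (fun θ => ‖f₀ θ‖ ^ 2) (arc 0 ω) :=
    (memLp_two_iff_integrable_sq_norm h₀.1).1 h₀
  have s₁ : Integrable (fun θ => ‖f₁ θ‖ ^ 2) (arc 0 ω) :=
    (memLp_two_iff_integrable_sq_norm h₁.1).1 h₁
  have hu := memLp_unfolded hω h₀ h₁
  have hint : ∫ θ in (-ω)..ω, ‖unfolded ω f₀ f₁ θ‖ ^ 2 =
      ∫ θ, ‖f₀ θ‖ ^ 2 + ‖f₁ θ‖ ^ 2 ∂(arc 0 ω) := by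
    rw [integral_split_neg hω ((memLp_two_iff_integrable_sq_norm hu.1).1 hu), integral_add s₀ s₁]
    congr 1
    · refine setIntegral_congr_fun measurableSet_Ioo fun θ hθ => ?_
      have hn : -θ ∉ Ioi (0 : ℝ) := by simpa using hθ.1.le
      simp only [unfolded, piecewise_eq_of_notMem _ _ _ hn, neg_neg, norm_mul, norm_phase, one_mul]
    · refine setIntegral_congr_fun measurableSet_Ioo fun θ hθ => ?_
      simp only [unfolded, piecewise_eq_of_mem _ _ _ (show θ ∈ Ioi (0 : ℝ) from hθ.1), norm_mul,
        norm_phase, one_mul]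
  simp only [fourierCoeffOn_unfolded hω h₀ h₁, hint, norm_smul, mul_pow] at hP
  have hP2 := hP.mul_left ((2 * ω) ^ 2)
  have e1 : ∀ k, (2 * ω) ^ 2 * (‖(1 / (2 * ω) : ℝ)‖ ^ 2 * ‖mode ω (freq ω k) f₀ f₁‖ ^ 2) =
      ‖mode ω (freq ω k) f₀ f₁‖ ^ 2 := fun k => by
    rw [Real.norm_of_nonneg (by positivity)]
    field_simp
  simp only [e1] at hP2
  have s : Integrable (fun θ => ‖f₀ θ‖ ^ 2 + ‖f₁ θ‖ ^ 2) (arc 0 ω) := s₀.add s₁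
  rw [← ofReal_integral_eq_lintegral_ofReal s (Eventually.of_forall fun θ => by positivity),
    ← ENNReal.ofReal_mul (by positivity),
    ← ENNReal.ofReal_tsum_of_nonneg (fun k => by positivity) hP2.summable, hP2.tsum_eq]
  congr 1
  simp only [smul_eq_mul]
  field_simp
  ring

theorem freq_zero_sq_le {ω : ℝ} (hω : 0 < ω) (hω2 : ω ≤ 2 * Real.pi) (k : ℤ) :
    (Real.pi - ω) ^ 2 / (4 * ω ^ 2) ≤ freq ω k ^ 2 := by
  have hπ := Real.pi_pos
  rw [freq, div_pow, mul_pow, show (2 : ℝ) ^ 2 = 4 by norm_num]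
  refine div_le_div_of_nonneg_right ?_ (by positivity)
  rcases le_or_gt 0 k with hk | hk
  · rcases hk.eq_or_lt with rfl | hk
    · simp; nlinarith
    · have h1 : (1 : ℝ) ≤ k := by exact_mod_cast hk
      nlinarith [mul_le_mul_of_nonneg_left h1 hπ.le]
  · have h1 : (k : ℝ) ≤ -1 := by exact_mod_cast (show k ≤ -1 by omega)
    nlinarith [mul_le_mul_of_nonneg_left h1 hπ.le]

/-- The quantization condition: the mode of frequency `μ_k` is compatible with the boundary
condition `ψ₁ = -e^{iω} ψ₀` on the edge `θ = ω`. -/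
theorem phase_freq {ω : ℝ} (hω : 0 < ω) (k : ℤ) :
    phase (freq ω k) ω = -(phase 1 ω * phase (-freq ω k) ω) := by
  have hne : phase (-freq ω k) ω * phase (freq ω k) ω = 1 := by
    rw [phase_mul_phase]; simp [phase]
  have h2 : phase (freq ω k) ω * phase (freq ω k) ω = -phase 1 ω := by
    rw [phase_mul_phase, phase, phase,
      show Complex.I * ((freq ω k + freq ω k) * ω : ℝ) =
        Complex.I * (1 * ω : ℝ) - Real.pi * Complex.I + k * (2 * Real.pi * Complex.I) by
      have : (ω : ℂ) ≠ 0 := by exact_mod_cast hω.ne'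
      rw [freq]; push_cast; field_simp; ring,
      Complex.exp_add, Complex.exp_int_mul_two_pi_mul_I, Complex.exp_sub, Complex.exp_pi_mul_I]
    simp [div_neg]
  linear_combination phase (-freq ω k) ω * h2 - phase (freq ω k) ω * hne

/-! ### Polar coordinates in a sector -/

/-- The point with polar coordinates `q = (r, θ)`. -/
noncomputable def polar (q : ℝ × ℝ) : Plane := q.1 • er q.2

/-- The identification of `ℂ` with the Euclidean plane. -/
noncomputable def toPlane : ℂ ≃ₗᵢ[ℝ] Plane := Complex.orthonormalBasisOneI.repr

theorem toPlane_apply (z : ℂ) : toPlane z = !₂[z.re, z.im] := by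
  simp [toPlane]
  rfl

theorem toPlane_polar (r θ : ℝ) : toPlane (r * (Real.cos θ + Real.sin θ * Complex.I)) =
    polar (r, θ) := by
  rw [toPlane_apply]
  ext i
  fin_cases i <;> simp [polar, er, -Complex.ofReal_cos, -Complex.ofReal_sin]

theorem polar_eq (r θ : ℝ) : polar (r, θ) = !₂[r * Real.cos θ, r * Real.sin θ] := by
  ext i
  fin_cases i <;> simp [polar, er]

theorem norm_er (θ : ℝ) : ‖er θ‖ = 1 := by
  simp [er, EuclideanSpace.norm_eq, Fin.sum_univ_two]

theorem norm_polar (q : ℝ × ℝ) : ‖polar q‖ = |q.1| := by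
  rw [polar, norm_smul, norm_er, mul_one, Real.norm_eq_abs]

theorem continuous_polar : Continuous polar := by
  unfold polar er
  fun_prop

theorem arg_neg_polar {r θ : ℝ} (hr : 0 < r) (hθ : θ ∈ Ioo 0 (2 * Real.pi)) :
    Complex.arg (-(r * (Real.cos θ + Real.sin θ * Complex.I))) = θ - Real.pi := by
  have hz : -((r : ℂ) * (Real.cos θ + Real.sin θ * Complex.I)) =
      r * (Complex.cos (θ - Real.pi : ℝ) + Complex.sin (θ - Real.pi : ℝ) * Complex.I) := by
    push_cast
    rw [Complex.cos_sub_pi, Complex.sin_sub_pi]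
    ring
  rw [hz, Complex.arg_mul_cos_add_sin_mul_I hr ⟨by linarith [hθ.1], by linarith [hθ.2]⟩]

/-- Membership in a sector is read off the argument with values in `(0, 2π)`, that is
`arg (-z) + π`. -/
theorem toPlane_mem_sectorBetween {α β : ℝ} (hα : 0 ≤ α) (hβ : β ≤ 2 * Real.pi) (z : ℂ) :
    toPlane z ∈ sectorBetween α β ↔
      -z ∈ Complex.slitPlane ∧ Complex.arg (-z) + Real.pi ∈ Ioo α β := by
  constructor
  · rintro ⟨r, θ, hr, h1, h2, h⟩
    rw [← polar_eq, ← toPlane_polar] at h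
    have harg : Complex.arg (-z) = θ - Real.pi := by
      rw [toPlane.injective h, arg_neg_polar hr ⟨by linarith, by linarith⟩]
    refine ⟨?_, ?_⟩
    · rw [Complex.mem_slitPlane_iff_arg, harg]
      refine ⟨by linarith, fun h0 => ?_⟩
      have hn : ‖toPlane z‖ = r := by rw [h, toPlane_polar, norm_polar, abs_of_pos hr]
      rw [toPlane.norm_map, ← norm_neg, h0, norm_zero] at hn
      exact hr.ne hn
    · rw [harg, sub_add_cancel]
      exact ⟨h1, h2⟩
  · rintro ⟨h0, h1, h2⟩
    have hne : -z ≠ 0 := Complex.slitPlane_ne_zero h0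
    refine ⟨‖-z‖, Complex.arg (-z) + Real.pi, norm_pos_iff.2 hne, h1, h2, ?_⟩
    rw [← polar_eq, ← toPlane_polar]
    congr 1
    have := Complex.norm_mul_cos_add_sin_mul_I (-z)
    push_cast
    rw [Complex.cos_add_pi, Complex.sin_add_pi]
    linear_combination this

theorem polar_mem_sectorBetween {α β r θ : ℝ} (hα : 0 ≤ α) (hβ : β ≤ 2 * Real.pi)
    (hr : 0 < r) (hθ : θ ∈ Ioo 0 (2 * Real.pi)) :
    polar (r, θ) ∈ sectorBetween α β ↔ θ ∈ Ioo α β := by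
  constructor
  · rintro ⟨r', θ', hr', h1, h2, h⟩
    rw [← polar_eq] at h
    rw [← toPlane_polar, ← toPlane_polar] at h
    have e := congrArg (fun z => Complex.arg (-z)) (toPlane.injective h)
    beta_reduce at e
    rw [arg_neg_polar hr hθ, arg_neg_polar hr' ⟨by linarith, by linarith⟩] at e
    rw [sub_left_inj.1 e]
    exact ⟨h1, h2⟩
  · intro h
    exact ⟨r, θ, hr, h.1, h.2, polar_eq r θ⟩

theorem isOpen_sectorBetween {α β : ℝ} (hα : 0 ≤ α) (hβ : β ≤ 2 * Real.pi) :
    IsOpen (sectorBetween α β) := by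
  have h : IsOpen {z : ℂ | -z ∈ Complex.slitPlane ∧ Complex.arg (-z) + Real.pi ∈ Ioo α β} := by
    have hc : ContinuousOn (fun z : ℂ => Complex.arg (-z) + Real.pi)
        {z | -z ∈ Complex.slitPlane} := fun z hz =>
      (((Complex.continuousAt_arg hz).comp (f := fun z : ℂ => -z)
        continuous_neg.continuousAt).add continuousAt_const).continuousWithinAt
    exact hc.isOpen_inter_preimage (Complex.isOpen_slitPlane.preimage continuous_neg) isOpen_Ioo
  have h2 : sectorBetween α β = toPlane.symm ⁻¹'
      {z : ℂ | -z ∈ Complex.slitPlane ∧ Complex.arg (-z) + Real.pi ∈ Ioo α β} := by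
    ext x
    rw [mem_preimage, mem_ofPred_eq, ← toPlane_mem_sectorBetween hα hβ,
      LinearIsometryEquiv.apply_symm_apply]
  rw [h2]
  exact h.preimage toPlane.symm.continuous

/-- The measure `r dr dθ` on `(0, ∞) × (α, β)`. -/
noncomputable abbrev polarMeasure (α β : ℝ) : Measure (ℝ × ℝ) := radialMeasure.prod (arc α β)

theorem polarMeasure_eq (α β : ℝ) : polarMeasure α β =
    (volume.restrict (Ioi (0 : ℝ) ×ˢ Ioo α β)).withDensity (fun q => ENNReal.ofReal q.1) := by
  rw [polarMeasure, radialMeasure, prod_withDensity_left ENNReal.measurable_ofReal,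
    Measure.prod_restrict]
  rfl

theorem ae_polarMeasure (α β : ℝ) :
    ∀ᵐ q ∂(polarMeasure α β), 0 < q.1 ∧ q.2 ∈ Ioo α β := by
  rw [polarMeasure_eq]
  refine (withDensity_absolutelyContinuous _ _).ae_le ?_
  filter_upwards [ae_restrict_mem (measurableSet_Ioi.prod measurableSet_Ioo)] with q hq
  exact hq

/-- Integration in polar coordinates with angles in `(0, 2π)`. -/
theorem lintegral_eq_polar (f : Plane → ENNReal) :
    ∫⁻ x, f x = ∫⁻ q in Ioi (0 : ℝ) ×ˢ Ioo 0 (2 * Real.pi), ENNReal.ofReal q.1 * f (polar q) := by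
  have h1 : ∫⁻ x, f x = ∫⁻ z : ℂ, f (toPlane (-z)) := by
    have := (toPlane.measurePreserving.comp
      (Measure.measurePreserving_neg (volume : Measure ℂ))).lintegral_comp_emb
      (toPlane.toHomeomorph.measurableEmbedding.comp
        (Homeomorph.neg ℂ).measurableEmbedding) f
    exact this.symm
  have h2 : MeasurePreserving (fun q : ℝ × ℝ => q + (0, Real.pi)) volume volume :=
    measurePreserving_add_right _ _
  have h3 := h2.restrict_preimage_emb (MeasurableEquiv.addRight ((0 : ℝ), Real.pi)).measurableEmbedding
    (Ioi (0 : ℝ) ×ˢ Ioo 0 (2 * Real.pi))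
  rw [h1, ← Complex.lintegral_comp_polarCoord_symm,
    ← h3.lintegral_comp_emb (MeasurableEquiv.addRight ((0 : ℝ), Real.pi)).measurableEmbedding]
  have hset : (fun q : ℝ × ℝ => q + (0, Real.pi)) ⁻¹' (Ioi (0 : ℝ) ×ˢ Ioo 0 (2 * Real.pi)) =
      polarCoord.target := by
    ext q
    simp only [polarCoord_target, mem_preimage, mem_prod, Prod.fst_add, Prod.snd_add, mem_Ioi,
      mem_Ioo, add_zero]
    constructor <;> rintro ⟨h, h', h''⟩ <;> exact ⟨h, by linarith, by linarith⟩
  rw [hset]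
  refine lintegral_congr fun q => ?_
  rw [Complex.polarCoord_symm_apply, smul_eq_mul]
  congr 2
  · simp
  · rw [show q + (0, Real.pi) = (q.1, q.2 + Real.pi) by ext <;> simp, ← toPlane_polar]
    congr 1
    push_cast
    rw [Complex.cos_add_pi, Complex.sin_add_pi]
    ring

theorem measurePreserving_polar {α β : ℝ} (hα : 0 ≤ α) (hβ : β ≤ 2 * Real.pi) :
    MeasurePreserving polar (polarMeasure α β) (volume.restrict (sectorBetween α β)) := by
  refine ⟨continuous_polar.measurable, ?_⟩
  ext s hs
  have hS := (isOpen_sectorBetween hα hβ).measurableSet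
  have hm : Measurable fun q : ℝ × ℝ => ENNReal.ofReal q.1 :=
    ENNReal.measurable_ofReal.comp measurable_fst
  have hps := continuous_polar.measurable hs
  rw [Measure.map_apply continuous_polar.measurable hs, Measure.restrict_apply hs,
    ← lintegral_indicator_one (hs.inter hS), lintegral_eq_polar, polarMeasure_eq,
    withDensity_apply _ hps, Measure.restrict_restrict hps,
    ← lintegral_indicator (hps.inter (measurableSet_Ioi.prod measurableSet_Ioo)),
    ← lintegral_indicator (measurableSet_Ioi.prod measurableSet_Ioo)]
  refine lintegral_congr fun q => ?_
  by_cases hq : q ∈ Ioi (0 : ℝ) ×ˢ Ioo 0 (2 * Real.pi)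
  · have key := polar_mem_sectorBetween hα hβ hq.1 hq.2
    by_cases h1 : q.2 ∈ Ioo α β
    · by_cases h2 : polar q ∈ s
      · rw [indicator_of_mem (show q ∈ polar ⁻¹' s ∩ Ioi 0 ×ˢ Ioo α β from ⟨h2, hq.1, h1⟩), indicator_of_mem hq,
          indicator_of_mem (show polar q ∈ s ∩ sectorBetween α β from ⟨h2, key.2 h1⟩)]
        simp
      · rw [indicator_of_notMem (fun h => h2 h.1), indicator_of_mem hq,
          indicator_of_notMem (fun h => h2 h.1), mul_zero]
    · rw [indicator_of_notMem (fun h => h1 h.2.2), indicator_of_mem hq,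
          indicator_of_notMem (fun h => h1 (key.1 h.2)), mul_zero]
  · rw [indicator_of_notMem hq, indicator_of_notMem]
    exact fun h => hq ⟨h.2.1, hα.trans_lt h.2.2.1, h.2.2.2.trans_le hβ⟩

/-! ### Integration by parts in polar coordinates for smooth functions -/

/-- The radial derivative `cos θ v₀ + sin θ v₁` at the point with polar coordinates `q = (r, θ)`
of a function with partial derivatives `v₀`, `v₁`. -/
noncomputable def radialPart (v : Fin 2 → Plane → Spinor) (q : ℝ × ℝ) : Spinor :=
  Real.cos q.2 • v 0 (polar q) + Real.sin q.2 • v 1 (polar q)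

/-- The angular derivative `-sin θ v₀ + cos θ v₁`, per unit length, at the point with polar
coordinates `q = (r, θ)` of a function with partial derivatives `v₀`, `v₁`. -/
noncomputable def angularPart (v : Fin 2 → Plane → Spinor) (q : ℝ × ℝ) : Spinor :=
  (-Real.sin q.2) • v 0 (polar q) + Real.cos q.2 • v 1 (polar q)

theorem hasDerivAt_er (θ : ℝ) : HasDerivAt er (eth θ) θ := by
  have h : HasDerivAt (fun t => ![Real.cos t, Real.sin t]) ![-Real.sin θ, Real.cos θ] θ := by
    rw [hasDerivAt_pi]
    intro i
    fin_cases i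
    · exact Real.hasDerivAt_cos θ
    · exact Real.hasDerivAt_sin θ
  exact ((PiLp.continuousLinearEquiv 2 ℝ (fun _ : Fin 2 => ℝ)).symm.toContinuousLinearMap.hasFDerivAt
    (x := ![Real.cos θ, Real.sin θ])).comp_hasDerivAt θ h

theorem fderiv_er {U : Plane → Spinor} (x : Plane) (θ : ℝ) :
    fderiv ℝ U x (er θ) = Real.cos θ • partialDeriv 0 U x + Real.sin θ • partialDeriv 1 U x := by
  have : er θ = Real.cos θ • EuclideanSpace.single 0 1 + Real.sin θ • EuclideanSpace.single 1 1 := by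
    ext i
    fin_cases i <;> simp [er]
  rw [this, map_add, map_smul, map_smul, partialDeriv, partialDeriv]

theorem fderiv_eth {U : Plane → Spinor} (x : Plane) (θ : ℝ) :
    fderiv ℝ U x (eth θ) =
      (-Real.sin θ) • partialDeriv 0 U x + Real.cos θ • partialDeriv 1 U x := by
  have : eth θ =
      (-Real.sin θ) • EuclideanSpace.single 0 1 + Real.cos θ • EuclideanSpace.single 1 1 := by
    ext i
    fin_cases i <;> simp [eth]
  rw [this, map_add, map_smul, map_smul, partialDeriv, partialDeriv]

theorem continuous_partialDeriv {F : Type} [NormedAddCommGroup F] [NormedSpace ℝ F]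
    {U : Plane → F} (hU : ContDiff ℝ (⊤ : ℕ∞) U) (j : Fin 2) :
    Continuous (partialDeriv j U) :=
  (hU.continuous_fderiv (by simp)).clm_apply continuous_const

theorem hasDerivAt_polar_left {U : Plane → Spinor} (hU : ContDiff ℝ (⊤ : ℕ∞) U) (r θ : ℝ) :
    HasDerivAt (fun s => U (polar (s, θ))) (radialPart (fun j => partialDeriv j U) (r, θ)) r := by
  have h1 : HasDerivAt (fun s : ℝ => polar (s, θ)) (er θ) r := by
    simpa [polar] using (hasDerivAt_id r).smul_const (er θ)
  have h2 := ((hU.differentiable (by simp)) (polar (r, θ))).hasFDerivAt.comp_hasDerivAt r h1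
  rw [fderiv_er] at h2
  exact h2

theorem hasDerivAt_polar_right {U : Plane → Spinor} (hU : ContDiff ℝ (⊤ : ℕ∞) U) (r θ : ℝ) :
    HasDerivAt (fun t => U (polar (r, t)))
      (r • angularPart (fun j => partialDeriv j U) (r, θ)) θ := by
  have h1 : HasDerivAt (fun t : ℝ => polar (r, t)) (r • eth θ) θ :=
    (hasDerivAt_er θ).const_smul r
  have h2 := ((hU.differentiable (by simp)) (polar (r, θ))).hasFDerivAt.comp_hasDerivAt θ h1
  rw [map_smul, fderiv_eth] at h2
  exact h2

theorem continuous_radialPart {v : Fin 2 → Plane → Spinor} (hv : ∀ j, Continuous (v j)) :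
    Continuous (radialPart v) := by
  exact ((Real.continuous_cos.comp continuous_snd).smul ((hv 0).comp continuous_polar)).add
    ((Real.continuous_sin.comp continuous_snd).smul ((hv 1).comp continuous_polar))

theorem continuous_angularPart {v : Fin 2 → Plane → Spinor} (hv : ∀ j, Continuous (v j)) :
    Continuous (angularPart v) := by
  exact ((Real.continuous_sin.comp continuous_snd).neg.smul ((hv 0).comp continuous_polar)).add
    ((Real.continuous_cos.comp continuous_snd).smul ((hv 1).comp continuous_polar))

theorem IsTest.div_id {χ : ℝ → ℝ} (h : IsTest χ) : IsTest (fun r => χ r / r) := by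
  obtain ⟨l, m, hl, -, -, hz⟩ := h.exists_Icc
  refine IsTest.of_Icc (contDiff_iff_contDiffAt.2 fun r => ?_) hl (m := m) fun r hr => ?_
  · rcases lt_or_ge 0 r with hr | hr
    · exact h.contDiff.contDiffAt.div contDiffAt_id hr.ne'
    · have : (fun r => χ r / r) =ᶠ[𝓝 r] fun _ => 0 := by
        filter_upwards [Iio_mem_nhds (hr.trans_lt hl)] with s hs
        rw [hz s fun hc => absurd hs (not_lt.2 hc.1.le), zero_div]
      exact contDiffAt_const.congr_of_eventuallyEq this
  · rw [hz r fun hc => hr (Ioo_subset_Icc_self hc), zero_div]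

theorem IsTest.id_mul {χ : ℝ → ℝ} (h : IsTest χ) : IsTest (fun r => r * χ r) := by
  obtain ⟨l, m, hl, -, -, hz⟩ := h.exists_Icc
  refine IsTest.of_Icc (contDiff_id.mul h.contDiff) hl (m := m) fun r hr => ?_
  rw [hz r fun hc => hr (Ioo_subset_Icc_self hc), mul_zero]

theorem IsTest.integrable_smul {F : Type*} [NormedAddCommGroup F] [NormedSpace ℝ F]
    {χ : ℝ → ℝ} (h : IsTest χ) {g : ℝ × ℝ → F} (hg : Continuous g) (α β : ℝ) :
    Integrable (fun q => χ q.1 • g q) (polarMeasure α β) := by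
  rw [polarMeasure_eq, integrable_withDensity_iff_integrable_smul' (by fun_prop) (by simp)]
  obtain ⟨l, m, hl, -, -, hz⟩ := h.exists_Icc
  have hc : Continuous fun q : ℝ × ℝ => q.1 • (χ q.1 • g q) := by
    have := h.contDiff.continuous
    fun_prop
  have hi : IntegrableOn (fun q : ℝ × ℝ => q.1 • (χ q.1 • g q)) (Icc l m ×ˢ Icc α β) :=
    hc.continuousOn.integrableOn_compact (isCompact_Icc.prod isCompact_Icc)
  have hi2 : IntegrableOn (fun q : ℝ × ℝ => q.1 • (χ q.1 • g q)) (Ioi (0 : ℝ) ×ˢ Ioo α β) := by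
    refine hi.of_forall_sdiff_eq_zero (measurableSet_Ioi.prod measurableSet_Ioo) fun q hq => ?_
    rw [hz q.1 fun hc => hq.2 ⟨Ioo_subset_Icc_self hc, Ioo_subset_Icc_self hq.1.2⟩, zero_smul,
      smul_zero]
  refine hi2.congr ?_
  filter_upwards [ae_restrict_mem (measurableSet_Ioi.prod measurableSet_Ioo)] with q hq
  rw [ENNReal.toReal_ofReal (le_of_lt hq.1)]

theorem IsTest.memLp_mul {χ : ℝ → ℝ} (h : IsTest χ) {E : ℝ → ℂ} (hE : Continuous E) (α β : ℝ) :
    MemLp (fun q : ℝ × ℝ => (χ q.1 : ℂ) * E q.2) 2 (polarMeasure α β) := by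
  have hχ := h.contDiff.continuous
  have hc : Continuous (fun q : ℝ × ℝ => (χ q.1 : ℂ) * E q.2) := by fun_prop
  rw [memLp_two_iff_integrable_sq_norm hc.aestronglyMeasurable]
  have := h.integrable_smul (g := fun q : ℝ × ℝ => χ q.1 * ‖E q.2‖ ^ 2) (by fun_prop) α β
  refine this.congr (Eventually.of_forall fun q => ?_)
  simp only [norm_mul, Complex.norm_real, mul_pow, smul_eq_mul, Real.norm_eq_abs, sq_abs]
  ring

theorem IsTest.integrable_mul_smul {χ : ℝ → ℝ} (h : IsTest χ) {E : ℝ → ℂ} (hE : Continuous E)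
    {g : ℝ × ℝ → Spinor} (hg : Continuous g) (α β : ℝ) :
    Integrable (fun q : ℝ × ℝ => ((χ q.1 : ℂ) * E q.2) • g q) (polarMeasure α β) := by
  refine (h.integrable_smul (g := fun q => E q.2 • g q) (by fun_prop) α β).congr
    (Eventually.of_forall fun q => ?_)
  simp only [mul_smul]
  rw [Complex.coe_smul]

theorem integral_radial_smooth {U : Plane → Spinor} (hU : ContDiff ℝ (⊤ : ℕ∞) U) {χ : ℝ → ℝ}
    (hχ : IsTest χ) {E : ℝ → ℂ} (hE : Continuous E) (α β : ℝ) :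
    ∫ q, ((deriv χ q.1 / q.1 : ℝ) * E q.2) • U (polar q) ∂(polarMeasure α β) +
      ∫ q, ((χ q.1 / q.1 : ℝ) * E q.2) • radialPart (fun j => partialDeriv j U) q
        ∂(polarMeasure α β) = 0 := by
  have hUc : Continuous fun q => U (polar q) := hU.continuous.comp continuous_polar
  have hRc := continuous_radialPart (continuous_partialDeriv hU)
  have i1 := hχ.deriv.div_id.integrable_mul_smul hE hUc α β
  have i2 := hχ.div_id.integrable_mul_smul hE hRc α β
  rw [← integral_add i1 i2]
  refine (integral_prod_symm _ (i1.add i2)).trans ?_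
  refine integral_eq_zero_of_ae (Eventually.of_forall fun θ => ?_)
  simp only [Pi.zero_apply, Pi.add_apply]
  rw [integral_radialMeasure]
  have hd : ∀ r, HasDerivAt (fun s => χ s • U (polar (s, θ)))
      (χ r • radialPart (fun j => partialDeriv j U) (r, θ) + deriv χ r • U (polar (r, θ))) r :=
    fun r => ((hχ.contDiff.differentiable (by simp)) r).hasDerivAt.smul (hasDerivAt_polar_left hU r θ)
  have hc1 : Continuous fun s => U (polar (s, θ)) := hUc.comp (by fun_prop : Continuous fun s => (s, θ))
  have hc2 : Continuous fun s => radialPart (fun j => partialDeriv j U) (s, θ) :=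
    hRc.comp (by fun_prop : Continuous fun s => (s, θ))
  have hχc := hχ.contDiff.continuous
  have hχc' := hχ.deriv.contDiff.continuous
  have j1 : Integrable (fun s => χ s • U (polar (s, θ))) :=
    (hχc.smul hc1).integrable_of_hasCompactSupport hχ.compact.smul_right
  have j2 : Integrable fun r => χ r • radialPart (fun j => partialDeriv j U) (r, θ) +
      deriv χ r • U (polar (r, θ)) :=
    ((hχc.smul hc2).integrable_of_hasCompactSupport hχ.compact.smul_right).add
      ((hχc'.smul hc1).integrable_of_hasCompactSupport hχ.deriv.compact.smul_right)
  have hz := integral_eq_zero_of_hasDerivAt_of_integrable hd j2 j1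
  calc ∫ r in Ioi 0, r • (((deriv χ r / r : ℝ) * E θ) • U (polar (r, θ)) +
        ((χ r / r : ℝ) * E θ) • radialPart (fun j => partialDeriv j U) (r, θ))
      = ∫ r in Ioi 0, E θ • (χ r • radialPart (fun j => partialDeriv j U) (r, θ) +
          deriv χ r • U (polar (r, θ))) := by
        refine setIntegral_congr_fun measurableSet_Ioi fun r hr => ?_
        have h0 : (0 : ℝ) < r := hr
        simp only [← Complex.coe_smul, smul_add, smul_smul]
        rw [add_comm]
        push_cast
        have : (r : ℂ) ≠ 0 := by exact_mod_cast h0.ne'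
        congr 2 <;> field_simp
    _ = ∫ r, E θ • (χ r • radialPart (fun j => partialDeriv j U) (r, θ) +
          deriv χ r • U (polar (r, θ))) := by
        refine setIntegral_eq_integral_of_forall_compl_eq_zero fun r hr => ?_
        rw [image_eq_zero_of_notMem_tsupport (fun h => hr (hχ.pos h)),
          image_eq_zero_of_notMem_tsupport (fun h => hr (hχ.deriv.pos h))]
        simp
    _ = 0 := by rw [integral_smul, hz, smul_zero]

theorem integral_angular_smooth {U : Plane → Spinor} (hU : ContDiff ℝ (⊤ : ℕ∞) U) {χ : ℝ → ℝ}
    (hχ : IsTest χ) {E : ℝ → ℂ} (hE : ContDiff ℝ 1 E) {α β : ℝ} (hαβ : α ≤ β) :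
    ∫ q, ((χ q.1 : ℂ) * deriv E q.2) • U (polar q) ∂(polarMeasure α β) +
      ∫ q, ((q.1 * χ q.1 : ℝ) * E q.2) • angularPart (fun j => partialDeriv j U) q
        ∂(polarMeasure α β) =
      ∫ r, (χ r : ℂ) • (E β • U (polar (r, β)) - E α • U (polar (r, α))) ∂radialMeasure := by
  have hUc : Continuous fun q => U (polar q) := hU.continuous.comp continuous_polar
  have hRc := continuous_angularPart (continuous_partialDeriv hU)
  have hE' : Continuous (deriv E) := hE.continuous_deriv le_rfl
  have i1 := hχ.integrable_mul_smul hE' hUc α β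
  have i2 := hχ.id_mul.integrable_mul_smul hE.continuous hRc α β
  rw [← integral_add i1 i2]
  refine (integral_prod _ (i1.add i2)).trans ?_
  refine integral_congr_ae (Eventually.of_forall fun r => ?_)
  have hd : ∀ θ, HasDerivAt (fun t => E t • U (polar (r, t)))
      (E θ • r • angularPart (fun j => partialDeriv j U) (r, θ) +
        deriv E θ • U (polar (r, θ))) θ :=
    fun θ => ((hE.differentiable (by simp)) θ).hasDerivAt.smul (hasDerivAt_polar_right hU r θ)
  have hEc := hE.continuous
  have hc1 : Continuous fun s => U (polar (r, s)) := hUc.comp (by fun_prop : Continuous fun s => (r, s))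
  have hc2 : Continuous fun s => angularPart (fun j => partialDeriv j U) (r, s) :=
    hRc.comp (by fun_prop : Continuous fun s => (r, s))
  have hcont : Continuous fun θ => E θ • r • angularPart (fun j => partialDeriv j U) (r, θ) +
        deriv E θ • U (polar (r, θ)) :=
    (hEc.smul (hc2.const_smul r)).add (hE'.smul hc1)
  have := intervalIntegral.integral_eq_sub_of_hasDerivAt (fun θ _ => hd θ)
    (hcont.intervalIntegrable α β)
  simp only [Pi.add_apply]
  rw [← this, intervalIntegral.integral_of_le hαβ, integral_Ioc_eq_integral_Ioo, ← integral_smul]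
  refine integral_congr_ae (Eventually.of_forall fun θ => ?_)
  simp only [← Complex.coe_smul, smul_add, smul_smul]
  rw [add_comm]
  push_cast
  congr 2
  ring

/-- Integration against an `L²` coefficient is continuous for `L²` convergence. -/
theorem tendsto_integral_smul_of_eLpNorm {X F : Type*} [MeasurableSpace X] {m : Measure X}
    [NormedAddCommGroup F] [NormedSpace ℂ F] {K : X → ℂ} (hK : MemLp K 2 m)
    {f : ℕ → X → F} {g : X → F} (hf : ∀ n, AEStronglyMeasurable (f n) m) (hg : MemLp g 2 m)
    (h : Tendsto (fun n => eLpNorm (fun x => f n x - g x) 2 m) atTop (𝓝 0)) :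
    Tendsto (fun n => ∫ x, K x • f n x ∂m) atTop (𝓝 (∫ x, K x • g x ∂m)) := by
  let _ : NormedSpace ℝ F := NormedSpace.complexToReal
  have hfin : ∀ᶠ n in atTop, eLpNorm (fun x => f n x - g x) 2 m < ⊤ :=
    h.eventually (gt_mem_nhds ENNReal.zero_lt_top)
  have hint : ∀ᶠ n in atTop, Integrable (fun x => K x • f n x) m := by
    filter_upwards [hfin] with n hn
    have h1 : MemLp (fun x => f n x - g x) 2 m := ⟨(hf n).sub hg.1, hn⟩
    have h2 : MemLp (f n) 2 m := by
      have := h1.add hg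
      exact this.ae_eq (Eventually.of_forall fun x => by simp)
    exact memLp_one_iff_integrable.1 (h2.smul hK)
  have hgi : Integrable (fun x => K x • g x) m := memLp_one_iff_integrable.1 (hg.smul hK)
  refine tendsto_integral_of_L1' _ hgi.1 hint ?_
  have hb : Tendsto (fun n => eLpNorm K 2 m * eLpNorm (fun x => f n x - g x) 2 m) atTop (𝓝 0) := by
    have := ENNReal.Tendsto.const_mul h (Or.inr hK.2.ne)
    simpa using this
  refine tendsto_of_tendsto_of_tendsto_of_le_of_le tendsto_const_nhds hb (fun n => zero_le)
    fun n => ?_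
  have := eLpNorm_smul_le_mul_eLpNorm (p := 2) (q := 2) (r := 1) ((hf n).sub hg.1) hK.1
  refine le_trans (le_of_eq ?_) this
  refine eLpNorm_congr_ae (Eventually.of_forall fun x => ?_)
  simp [smul_sub]

/-! ### Integration by parts up to an edge for Sobolev functions -/

theorem memLp_comp_polar {α β : ℝ} (hα : 0 ≤ α) (hβ : β ≤ 2 * Real.pi) {u : Plane → Spinor}
    (hu : MemLp u 2 (volume.restrict (sectorBetween α β))) :
    MemLp (fun q => u (polar q)) 2 (polarMeasure α β) :=
  hu.comp_measurePreserving (measurePreserving_polar hα hβ)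

theorem eLpNorm_comp_polar_sub {α β : ℝ} (hα : 0 ≤ α) (hβ : β ≤ 2 * Real.pi)
    {U u : Plane → Spinor} (hU : Continuous U)
    (hu : MemLp u 2 (volume.restrict (sectorBetween α β))) :
    eLpNorm (fun q => U (polar q) - u (polar q)) 2 (polarMeasure α β) =
      eLpNorm (fun x => U x - u x) 2 (volume.restrict (sectorBetween α β)) :=
  eLpNorm_comp_measurePreserving (hU.aestronglyMeasurable.sub hu.1)
    (measurePreserving_polar hα hβ)

theorem memLp_rotated {X : Type*} [MeasurableSpace X] {m : Measure X} {a b : X → ℝ}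
    (ha : AEStronglyMeasurable a m) (hb : AEStronglyMeasurable b m)
    (ha1 : ∀ x, |a x| ≤ 1) (hb1 : ∀ x, |b x| ≤ 1) {f g : X → Spinor}
    (hf : MemLp f 2 m) (hg : MemLp g 2 m) : MemLp (fun x => a x • f x + b x • g x) 2 m := by
  have hle : ∀ {c : X → ℝ} {h : X → Spinor}, (∀ x, |c x| ≤ 1) → ∀ x, ‖c x • h x‖ ≤ ‖h x‖ :=
    fun hc x => by
      rw [norm_smul, Real.norm_eq_abs]
      exact mul_le_of_le_one_left (norm_nonneg _) (hc x)
  exact (hf.of_le (ha.smul hf.1) (Eventually.of_forall (hle ha1))).add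
    (hg.of_le (hb.smul hg.1) (Eventually.of_forall (hle hb1)))

theorem memLp_radialPart {α β : ℝ} (hα : 0 ≤ α) (hβ : β ≤ 2 * Real.pi)
    {v : Fin 2 → Plane → Spinor}
    (hv : ∀ j, MemLp (v j) 2 (volume.restrict (sectorBetween α β))) :
    MemLp (radialPart v) 2 (polarMeasure α β) :=
  memLp_rotated (by fun_prop) (by fun_prop) (fun q => Real.abs_cos_le_one _)
    (fun q => Real.abs_sin_le_one _) (memLp_comp_polar hα hβ (hv 0)) (memLp_comp_polar hα hβ (hv 1))

theorem memLp_angularPart {α β : ℝ} (hα : 0 ≤ α) (hβ : β ≤ 2 * Real.pi)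
    {v : Fin 2 → Plane → Spinor}
    (hv : ∀ j, MemLp (v j) 2 (volume.restrict (sectorBetween α β))) :
    MemLp (angularPart v) 2 (polarMeasure α β) :=
  memLp_rotated (by fun_prop) (by fun_prop)
    (fun q => by rw [abs_neg]; exact Real.abs_sin_le_one _)
    (fun q => Real.abs_cos_le_one _) (memLp_comp_polar hα hβ (hv 0)) (memLp_comp_polar hα hβ (hv 1))

theorem eLpNorm_rotated_le {X : Type*} [MeasurableSpace X] {m : Measure X} {a b : X → ℝ}
    (ha : AEStronglyMeasurable a m) (hb : AEStronglyMeasurable b m)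
    (ha1 : ∀ x, |a x| ≤ 1) (hb1 : ∀ x, |b x| ≤ 1) {f g f' g' : X → Spinor}
    (hf : AEStronglyMeasurable (fun x => f x - f' x) m)
    (hg : AEStronglyMeasurable (fun x => g x - g' x) m) :
    eLpNorm (fun x => (a x • f x + b x • g x) - (a x • f' x + b x • g' x)) 2 m ≤
      eLpNorm (fun x => f x - f' x) 2 m + eLpNorm (fun x => g x - g' x) 2 m := by
  have hle : ∀ {c : X → ℝ} {h : X → Spinor}, (∀ x, |c x| ≤ 1) → ∀ x, ‖c x • h x‖ ≤ ‖h x‖ :=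
    fun hc x => by
      rw [norm_smul, Real.norm_eq_abs]
      exact mul_le_of_le_one_left (norm_nonneg _) (hc x)
  have e : (fun x => (a x • f x + b x • g x) - (a x • f' x + b x • g' x)) =
      (fun x => a x • (f x - f' x)) + fun x => b x • (g x - g' x) := by
    ext1 x
    simp only [Pi.add_apply, smul_sub]
    abel
  rw [e]
  refine (eLpNorm_add_le (ha.smul hf) (hb.smul hg) (by norm_num)).trans ?_
  exact add_le_add (eLpNorm_mono (hle ha1)) (eLpNorm_mono (hle hb1))

section

variable {α β : ℝ} {u : Plane → Spinor} {v : Fin 2 → Plane → Spinor} {U : ℕ → Plane → Spinor}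

theorem tendsto_integral_comp_polar (hα : 0 ≤ α) (hβ : β ≤ 2 * Real.pi)
    (hu : MemLp u 2 (volume.restrict (sectorBetween α β)))
    (hU : ∀ n, Continuous (U n))
    (hlim : Tendsto (fun n => eLpNorm (fun x => U n x - u x) 2
      (volume.restrict (sectorBetween α β))) atTop (𝓝 0))
    {K : ℝ × ℝ → ℂ} (hK : MemLp K 2 (polarMeasure α β)) :
    Tendsto (fun n => ∫ q, K q • U n (polar q) ∂(polarMeasure α β)) atTop
      (𝓝 (∫ q, K q • u (polar q) ∂(polarMeasure α β))) := by
  refine tendsto_integral_smul_of_eLpNorm hK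
    (fun n => ((hU n).comp continuous_polar).aestronglyMeasurable) (memLp_comp_polar hα hβ hu) ?_
  exact hlim.congr fun n => (eLpNorm_comp_polar_sub hα hβ (hU n) hu).symm

theorem tendsto_integral_rotated (hα : 0 ≤ α) (hβ : β ≤ 2 * Real.pi)
    (hv : ∀ j, MemLp (v j) 2 (volume.restrict (sectorBetween α β)))
    (hU : ∀ n, ContDiff ℝ (⊤ : ℕ∞) (U n))
    (hlim : ∀ j, Tendsto (fun n => eLpNorm (fun x => partialDeriv j (U n) x - v j x) 2
      (volume.restrict (sectorBetween α β))) atTop (𝓝 0))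
    {K : ℝ × ℝ → ℂ} (hK : MemLp K 2 (polarMeasure α β)) {a b : ℝ × ℝ → ℝ}
    (ha : Continuous a) (hb : Continuous b) (ha1 : ∀ x, |a x| ≤ 1) (hb1 : ∀ x, |b x| ≤ 1) :
    Tendsto (fun n => ∫ q, K q • (a q • partialDeriv 0 (U n) (polar q) +
        b q • partialDeriv 1 (U n) (polar q)) ∂(polarMeasure α β)) atTop
      (𝓝 (∫ q, K q • (a q • v 0 (polar q) + b q • v 1 (polar q)) ∂(polarMeasure α β))) := by
  have hm : ∀ n j, AEStronglyMeasurable (fun q => partialDeriv j (U n) (polar q))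
      (polarMeasure α β) := fun n j =>
    ((continuous_partialDeriv (hU n) j).comp continuous_polar).aestronglyMeasurable
  have hvm : ∀ j, MemLp (fun q => v j (polar q)) 2 (polarMeasure α β) := fun j =>
    memLp_comp_polar hα hβ (hv j)
  have ham := ha.aestronglyMeasurable (μ := polarMeasure α β)
  have hbm := hb.aestronglyMeasurable (μ := polarMeasure α β)
  refine tendsto_integral_smul_of_eLpNorm hK
    (fun n => (ham.smul (hm n 0)).add (hbm.smul (hm n 1)))
    (memLp_rotated ham hbm ha1 hb1 (hvm 0) (hvm 1)) ?_
  have hsum := (hlim 0).add (hlim 1)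
  rw [add_zero] at hsum
  refine tendsto_of_tendsto_of_tendsto_of_le_of_le tendsto_const_nhds hsum (fun n => zero_le)
    fun n => ?_
  have := eLpNorm_rotated_le ham hbm ha1 hb1 ((hm n 0).sub (hvm 0).1) ((hm n 1).sub (hvm 1).1)
  refine this.trans (le_of_eq ?_)
  rw [eLpNorm_comp_polar_sub hα hβ (continuous_partialDeriv (hU n) 0) (hv 0),
    eLpNorm_comp_polar_sub hα hβ (continuous_partialDeriv (hU n) 1) (hv 1)]

end

/-- Weak differentiation in the radial direction, tested against `χ(r) E(θ)`. There is no condition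
on `E` at the edges, because radial lines do not cross them. -/
theorem integral_radial_of_isEdgeTrace {α β θ₀ : ℝ} (hα : 0 ≤ α) (hβ : β ≤ 2 * Real.pi)
    {u : Plane → Spinor} {g : ℝ → Spinor} (ht : IsEdgeTrace (sectorBetween α β) θ₀ u g)
    (hu : MemLp u 2 (volume.restrict (sectorBetween α β)))
    (hv : ∀ j, MemLp (weakPartial (sectorBetween α β) j u) 2
      (volume.restrict (sectorBetween α β)))
    {χ : ℝ → ℝ} (hχ : IsTest χ) {E : ℝ → ℂ} (hE : Continuous E) :
    ∫ q, ((deriv χ q.1 / q.1 : ℝ) * E q.2) • u (polar q) ∂(polarMeasure α β) +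
      ∫ q, ((χ q.1 / q.1 : ℝ) * E q.2) •
        radialPart (fun j => weakPartial (sectorBetween α β) j u) q ∂(polarMeasure α β) = 0 := by
  obtain ⟨-, U, hU, h1, h2, -⟩ := ht
  have l1 := tendsto_integral_comp_polar hα hβ hu (fun n => (hU n).1.continuous) h1
    (hχ.deriv.div_id.memLp_mul hE α β)
  have l2 := tendsto_integral_rotated hα hβ hv (fun n => (hU n).1) h2
    (hχ.div_id.memLp_mul hE α β) (a := fun q => Real.cos q.2) (b := fun q => Real.sin q.2)
    (by fun_prop) (by fun_prop) (fun q => Real.abs_cos_le_one _) (fun q => Real.abs_sin_le_one _)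
  refine tendsto_nhds_unique (l1.add l2) ?_
  refine tendsto_const_nhds.congr fun n => ?_
  exact (integral_radial_smooth (hU n).1 hχ hE α β).symm

/-- Weak differentiation in the angular direction, tested against `χ(r) E(θ)` where `E` vanishes at
the edge opposite to `θ₀`; the boundary term is the trace on the edge `θ₀`. -/
theorem integral_angular_of_isEdgeTrace {α β θ₀ : ℝ} (hα : 0 ≤ α) (hαβ : α ≤ β)
    (hβ : β ≤ 2 * Real.pi)
    {u : Plane → Spinor} {g : ℝ → Spinor} (ht : IsEdgeTrace (sectorBetween α β) θ₀ u g)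
    (hu : MemLp u 2 (volume.restrict (sectorBetween α β)))
    (hv : ∀ j, MemLp (weakPartial (sectorBetween α β) j u) 2
      (volume.restrict (sectorBetween α β)))
    {χ : ℝ → ℝ} (hχ : IsTest χ) {E : ℝ → ℂ} (hE : ContDiff ℝ 1 E) {s : ℂ}
    (hs : ∀ f : ℝ → Spinor, E β • f β - E α • f α = s • f θ₀) :
    ∫ q, ((χ q.1 : ℂ) * deriv E q.2) • u (polar q) ∂(polarMeasure α β) +
      ∫ q, ((q.1 * χ q.1 : ℝ) * E q.2) •
        angularPart (fun j => weakPartial (sectorBetween α β) j u) q ∂(polarMeasure α β) =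
      ∫ r in Ioi 0, ((r * χ r : ℝ) * s) • g r := by
  obtain ⟨hg, U, hU, h1, h2, h3⟩ := ht
  have l1 := tendsto_integral_comp_polar hα hβ hu (fun n => (hU n).1.continuous) h1
    (hχ.memLp_mul (hE.continuous_deriv le_rfl) α β)
  have l2 := tendsto_integral_rotated hα hβ hv (fun n => (hU n).1) h2
    (hχ.id_mul.memLp_mul hE.continuous α β) (a := fun q => -Real.sin q.2)
    (b := fun q => Real.cos q.2)
    (by fun_prop) (by fun_prop) (fun q => by rw [abs_neg]; exact Real.abs_sin_le_one _)
    (fun q => Real.abs_cos_le_one _)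
  have hK : MemLp (fun r : ℝ => ((r * χ r : ℝ) : ℂ) * s) 2 (volume.restrict (Ioi 0)) := by
    have hc := hχ.id_mul.contDiff.continuous
    have hcc : Continuous fun r : ℝ => ((r * χ r : ℝ) : ℂ) * s := by fun_prop
    refine MemLp.restrict _ (hcc.memLp_of_hasCompactSupport ?_)
    refine hχ.id_mul.compact.mono' (fun r hr => ?_)
    refine subset_tsupport _ fun h0 => hr ?_
    change ((r * χ r : ℝ) : ℂ) * s = 0
    rw [h0, Complex.ofReal_zero, zero_mul]
  have l3 := tendsto_integral_smul_of_eLpNorm hK (fun n => by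
    exact ((hU n).1.continuous.comp
      (by fun_prop : Continuous fun r : ℝ => r • er θ₀)).aestronglyMeasurable) hg h3
  refine tendsto_nhds_unique (l1.add l2) (l3.congr fun n => ?_)
  refine Eq.trans ?_ (integral_angular_smooth (hU n).1 hχ hE hαβ).symm
  rw [integral_radialMeasure]
  refine setIntegral_congr_fun measurableSet_Ioi fun r _ => ?_
  simp only [hs fun t => U n (polar (r, t)), ← Complex.coe_smul, smul_smul]
  push_cast
  rw [mul_assoc]
  rfl

/-! ### Test functions in polar coordinates and the interior of the sector -/

/-- The angle in `(0, 2π)` of a point off the half-line `{(x₁, 0) : x₁ ≥ 0}`. -/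
noncomputable def angle (x : Plane) : ℝ := (Complex.log (-toPlane.symm x)).im + Real.pi

theorem angle_polar {r θ : ℝ} (hr : 0 < r) (hθ : θ ∈ Ioo 0 (2 * Real.pi)) :
    angle (polar (r, θ)) = θ := by
  rw [angle, ← toPlane_polar, LinearIsometryEquiv.symm_apply_apply, Complex.log_im,
    arg_neg_polar hr hθ, sub_add_cancel]

theorem contDiffAt_angle {α β : ℝ} (hα : 0 ≤ α) (hβ : β ≤ 2 * Real.pi) {x : Plane}
    (hx : x ∈ sectorBetween α β) : ContDiffAt ℝ (⊤ : ℕ∞) angle x := by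
  have hs : -toPlane.symm x ∈ Complex.slitPlane := by
    have := (toPlane_mem_sectorBetween hα hβ (toPlane.symm x)).1 (by simpa using hx)
    exact this.1
  have h1 : ContDiffAt ℝ (⊤ : ℕ∞) Complex.log (-toPlane.symm x) :=
    (Complex.contDiffAt_log hs).restrict_scalars ℝ
  have h2 : ContDiffAt ℝ (⊤ : ℕ∞) (fun y : Plane => -toPlane.symm y) x :=
    (toPlane.symm.contDiff.neg).contDiffAt
  have h3 : ContDiffAt ℝ (⊤ : ℕ∞) (fun y : Plane => Complex.log (-toPlane.symm y)) x :=
    ContDiffAt.comp (g := Complex.log) (f := fun y : Plane => -toPlane.symm y) x h1 h2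
  exact (Complex.imCLM.contDiff.contDiffAt.comp x h3).add contDiffAt_const

open Classical in
/-- The function `χ(r) η(θ)` in the sector `(α, β)`, extended by zero. -/
noncomputable def polarTest (α β : ℝ) (χ η : ℝ → ℝ) (x : Plane) : ℝ :=
  if x ∈ sectorBetween α β then χ ‖x‖ * η (angle x) else 0

theorem polarTest_polar {α β : ℝ} (hα : 0 ≤ α) (hβ : β ≤ 2 * Real.pi) {χ η : ℝ → ℝ} {r θ : ℝ}
    (hr : 0 < r) (hθ : θ ∈ Ioo α β) : polarTest α β χ η (polar (r, θ)) = χ r * η θ := by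
  have hθ' : θ ∈ Ioo 0 (2 * Real.pi) := ⟨hα.trans_lt hθ.1, hθ.2.trans_le hβ⟩
  rw [polarTest, if_pos ((polar_mem_sectorBetween hα hβ hr hθ').2 hθ), norm_polar,
    angle_polar hr hθ', abs_of_pos hr]

theorem exists_compact_polarTest {α β a b : ℝ} (hα : 0 ≤ α) (hβ : β ≤ 2 * Real.pi)
    (ha : α < a) (hb : b < β) {χ η : ℝ → ℝ} (hχ : IsTest χ) (hη : ∀ θ, θ ∉ Icc a b → η θ = 0) :
    ∃ T, IsCompact T ∧ T ⊆ sectorBetween α β ∧ ∀ x, x ∉ T → polarTest α β χ η x = 0 := by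
  obtain ⟨l, m, hl, -, -, hz⟩ := hχ.exists_Icc
  refine ⟨polar '' (Icc l m ×ˢ Icc a b), (isCompact_Icc.prod isCompact_Icc).image continuous_polar,
    ?_, fun x hx => ?_⟩
  · rintro - ⟨⟨r, θ⟩, ⟨h1, h2⟩, rfl⟩
    have h1' : l ≤ r := h1.1
    have h2' : a ≤ θ ∧ θ ≤ b := h2
    exact ⟨r, θ, by linarith, by linarith, by linarith, polar_eq r θ⟩
  · by_cases hS : x ∈ sectorBetween α β
    · obtain ⟨r, θ, hr, h1, h2, rfl⟩ := hS
      rw [← polar_eq] at hx ⊢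
      rw [polarTest_polar hα hβ hr ⟨h1, h2⟩]
      by_cases hθ : θ ∈ Icc a b
      · rw [hz r fun hc => hx ⟨(r, θ), ⟨Ioo_subset_Icc_self hc, hθ⟩, rfl⟩, zero_mul]
      · rw [hη θ hθ, mul_zero]
    · rw [polarTest, if_neg hS]

theorem contDiff_polarTest {α β a b : ℝ} (hα : 0 ≤ α) (hβ : β ≤ 2 * Real.pi)
    (ha : α < a) (hb : b < β) {χ η : ℝ → ℝ} (hχ : IsTest χ) (hη : ContDiff ℝ (⊤ : ℕ∞) η)
    (hηz : ∀ θ, θ ∉ Icc a b → η θ = 0) : ContDiff ℝ (⊤ : ℕ∞) (polarTest α β χ η) := by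
  obtain ⟨T, hT, hTS, hz⟩ := exists_compact_polarTest hα hβ ha hb hχ hηz
  rw [contDiff_iff_contDiffAt]
  intro x
  by_cases hx : x ∈ sectorBetween α β
  · have he : polarTest α β χ η =ᶠ[𝓝 x] fun y => χ ‖y‖ * η (angle y) := by
      filter_upwards [(isOpen_sectorBetween hα hβ).mem_nhds hx] with y hy
      rw [polarTest, if_pos hy]
    refine ContDiffAt.congr_of_eventuallyEq ?_ he
    have hx0 : x ≠ 0 := by
      obtain ⟨r, θ, hr, -, -, rfl⟩ := hx
      rw [← polar_eq, ← norm_ne_zero_iff, norm_polar]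
      exact (abs_pos.2 hr.ne').ne'
    exact (hχ.contDiff.contDiffAt.comp x (contDiffAt_norm ℝ hx0)).mul
      (hη.contDiffAt.comp x (contDiffAt_angle hα hβ hx))
  · have he : polarTest α β χ η =ᶠ[𝓝 x] fun _ => 0 := by
      filter_upwards [hT.isClosed.isOpen_compl.mem_nhds fun h => hx (hTS h)] with y hy
      exact hz y hy
    exact contDiffAt_const.congr_of_eventuallyEq he

theorem integral_comp_polar {F : Type*} [NormedAddCommGroup F] [NormedSpace ℝ F] {α β : ℝ}
    (hα : 0 ≤ α) (hβ : β ≤ 2 * Real.pi) {f : Plane → F}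
    (hf : AEStronglyMeasurable f (volume.restrict (sectorBetween α β))) :
    ∫ x in sectorBetween α β, f x = ∫ q, f (polar q) ∂(polarMeasure α β) := by
  have h := measurePreserving_polar hα hβ
  rw [← h.map_eq] at hf ⊢
  exact integral_map h.measurable.aemeasurable hf

theorem partialDeriv_coord_mul {φ : Plane → ℝ} (hφ : ContDiff ℝ (⊤ : ℕ∞) φ) {i j : Fin 2}
    (hij : i ≠ j) (c : ℝ) (x : Plane) :
    partialDeriv j (fun y => c * y i * φ y) x = c * x i * partialDeriv j φ x := by
  have h1 : HasFDerivAt (fun y : Plane => c * y i)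
      (c • (EuclideanSpace.proj i : Plane →L[ℝ] ℝ)) x :=
    (EuclideanSpace.proj i : Plane →L[ℝ] ℝ).hasFDerivAt.const_mul c
  have h2 := ((hφ.differentiable (by simp)) x).hasFDerivAt
  have h3 : HasFDerivAt (fun y : Plane => c * y i * φ y) _ x := h1.mul h2
  rw [partialDeriv, h3.fderiv, partialDeriv]
  simp [hij]

theorem contDiff_coord_mul {φ : Plane → ℝ} (hφ : ContDiff ℝ (⊤ : ℕ∞) φ) (i : Fin 2) (c : ℝ) :
    ContDiff ℝ (⊤ : ℕ∞) fun y : Plane => c * y i * φ y :=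
  (contDiff_const.mul (EuclideanSpace.proj i : Plane →L[ℝ] ℝ).contDiff).mul hφ

/-- Weak differentiation in the angular direction, tested against `χ(r) η(θ)` with `η` supported
inside the sector. In Cartesian terms `∂_θ = ∂₁(x₀ ·) - ∂₀(x₁ ·)`, so that this is the definition of
the weak partial derivatives applied to the test functions `x₀ χ η` and `-x₁ χ η`. -/
theorem integral_angular_interior_real {α β a b : ℝ} (hα : 0 ≤ α) (hβ : β ≤ 2 * Real.pi)
    (ha : α < a) (hb : b < β) {u : Plane → Spinor} {v : Fin 2 → Plane → Spinor}
    (hu : MemLp u 2 (volume.restrict (sectorBetween α β)))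
    (hv : ∀ j, IsWeakPartial (sectorBetween α β) j u (v j)) {χ η : ℝ → ℝ} (hχ : IsTest χ)
    (hη : ContDiff ℝ (⊤ : ℕ∞) η) (hηz : ∀ θ, θ ∉ Icc a b → η θ = 0) :
    ∫ q, ((χ q.1 * deriv η q.2) • u (polar q) + (q.1 * χ q.1 * η q.2) • angularPart v q)
      ∂(polarMeasure α β) = 0 := by
  obtain ⟨T, hT, hTS, hz⟩ := exists_compact_polarTest hα hβ ha hb hχ hηz
  set S := sectorBetween α β with hS
  set φ := polarTest α β χ η with hφd
  have hφ : ContDiff ℝ (⊤ : ℕ∞) φ := contDiff_polarTest hα hβ ha hb hχ hη hηz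
  have supp : ∀ ρ : Plane → ℝ, (∀ x, φ x = 0 → ρ x = 0) → tsupport ρ ⊆ T := fun ρ h =>
    closure_minimal (fun x hx => by by_contra hc; exact hx (h x (hz x hc))) hT.isClosed
  have hcs : ∀ ρ : Plane → ℝ, (∀ x, φ x = 0 → ρ x = 0) → HasCompactSupport ρ := fun ρ h =>
    hT.of_isClosed_subset (isClosed_tsupport _) (supp ρ h)
  have test : ∀ (i j : Fin 2) (c : ℝ), i ≠ j →
      IntegrableOn (fun x => (c * x i * partialDeriv j φ x) • u x) S ∧
      IntegrableOn (fun x => (c * x i * φ x) • v j x) S ∧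
      ∫ x in S, (c * x i * partialDeriv j φ x) • u x = -∫ x in S, (c * x i * φ x) • v j x := by
    intro i j c hij
    have hsm := contDiff_coord_mul hφ i c
    have h0 : ∀ x, φ x = 0 → c * x i * φ x = 0 := fun x hx => by rw [hx, mul_zero]
    have hw := (hv j).2 _ hsm (hcs _ h0) ((supp _ h0).trans hTS)
    simp only [partialDeriv_coord_mul hφ hij] at hw
    refine ⟨?_, ?_, hw⟩
    · have hc := continuous_partialDeriv hsm j
      have hcomp : HasCompactSupport (partialDeriv j fun y : Plane => c * y i * φ y) :=
        (hcs _ h0).fderiv_apply ℝ _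
      have hm := (hc.memLp_of_hasCompactSupport (μ := volume) (p := 2) hcomp).restrict S
      have := memLp_one_iff_integrable.1 (hu.smul hm)
      refine this.congr (Eventually.of_forall fun x => ?_)
      simp only [Pi.smul_apply', partialDeriv_coord_mul hφ hij]
    · have hm := (hsm.continuous.memLp_of_hasCompactSupport (μ := volume) (p := 2)
        (hcs _ h0)).restrict S
      exact memLp_one_iff_integrable.1 ((hv j).1.smul hm)
  obtain ⟨i1, i2, e1⟩ := test 1 0 (-1) (by decide)
  obtain ⟨i3, i4, e2⟩ := test 0 1 1 (by decide)
  have j1 : IntegrableOn (fun x => (-1 * x 1 * partialDeriv 0 φ x) • u x +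
      (-1 * x 1 * φ x) • v 0 x) S := i1.add i2
  have j2 : IntegrableOn (fun x => (1 * x 0 * partialDeriv 1 φ x) • u x +
      (1 * x 0 * φ x) • v 1 x) S := i3.add i4
  have j : IntegrableOn (fun x => ((-1 * x 1 * partialDeriv 0 φ x) • u x +
      (-1 * x 1 * φ x) • v 0 x) + ((1 * x 0 * partialDeriv 1 φ x) • u x +
      (1 * x 0 * φ x) • v 1 x)) S := j1.add j2
  have hsum : ∫ x in S, (((-1 * x 1 * partialDeriv 0 φ x) • u x + (-1 * x 1 * φ x) • v 0 x) +
      ((1 * x 0 * partialDeriv 1 φ x) • u x + (1 * x 0 * φ x) • v 1 x)) = 0 := by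
    rw [integral_add j1 j2, integral_add i1 i2, integral_add i3 i4, e1, e2]
    simp
  rw [hS, integral_comp_polar hα hβ j.1] at hsum
  rw [← hsum]
  refine integral_congr_ae ?_
  filter_upwards [ae_polarMeasure α β] with q hq
  obtain ⟨r, θ⟩ := q
  obtain ⟨hr, hθ⟩ := hq
  simp only at hr hθ
  -- The angular derivative of `φ`, computed in Cartesian and in polar coordinates.
  have hder : -(r * Real.sin θ) * partialDeriv 0 φ (polar (r, θ)) +
      r * Real.cos θ * partialDeriv 1 φ (polar (r, θ)) = χ r * deriv η θ := by
    have d1 : HasDerivAt (fun t => φ (polar (r, t)))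
        (fderiv ℝ φ (polar (r, θ)) (r • eth θ)) θ := by
      have h1 : HasDerivAt (fun t : ℝ => polar (r, t)) (r • eth θ) θ :=
        (hasDerivAt_er θ).const_smul r
      exact ((hφ.differentiable (by simp)) (polar (r, θ))).hasFDerivAt.comp_hasDerivAt θ h1
    have d2 : HasDerivAt (fun t => φ (polar (r, t))) (χ r * deriv η θ) θ := by
      refine (((hη.differentiable (by simp)) θ).hasDerivAt.const_mul (χ r)).congr_of_eventuallyEq ?_
      filter_upwards [isOpen_Ioo.mem_nhds hθ] with t ht
      exact polarTest_polar hα hβ hr ht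
    have he : r • eth θ = (-(r * Real.sin θ)) • EuclideanSpace.single 0 1 +
        (r * Real.cos θ) • EuclideanSpace.single 1 1 := by
      ext i
      fin_cases i <;> simp [eth]
    have := d1.unique d2
    rw [he, map_add, map_smul, map_smul] at this
    exact this
  have hp : φ (polar (r, θ)) = χ r * η θ := polarTest_polar hα hβ hr hθ
  have c0 : polar (r, θ) 0 = r * Real.cos θ := by simp [polar_eq]
  have c1 : polar (r, θ) 1 = r * Real.sin θ := by simp [polar_eq]
  simp only [hp, c0, c1, angularPart, ← hder]
  module

/-! ### Weak partial derivatives on subdomains -/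

theorem MemH1.isWeakPartial {Ω : Set Plane} {u : Plane → Spinor} (h : MemH1 Ω u) (j : Fin 2) :
    IsWeakPartial Ω j u (weakPartial Ω j u) := by
  rw [weakPartial, dif_pos (h.2 j)]
  exact (h.2 j).choose_spec

theorem IsWeakPartial.mono {Ω Ω' : Set Plane} (hΩ : Ω' ⊆ Ω) {j : Fin 2} {u v : Plane → Spinor}
    (h : IsWeakPartial Ω j u v) : IsWeakPartial Ω' j u v := by
  refine ⟨h.1.mono_measure (Measure.restrict_mono hΩ le_rfl), fun φ hφ hc hs => ?_⟩
  have hz : ∀ x, x ∉ Ω' → φ x = 0 ∧ partialDeriv j φ x = 0 := fun x hx => by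
    have h0 : x ∉ tsupport φ := fun h => hx (hs h)
    refine ⟨image_eq_zero_of_notMem_tsupport h0, ?_⟩
    rw [partialDeriv, fderiv_of_notMem_tsupport ℝ h0]
    rfl
  have e : ∀ {Ω'' : Set Plane}, Ω' ⊆ Ω'' → (∫ x in Ω'', partialDeriv j φ x • u x =
      ∫ x, partialDeriv j φ x • u x) ∧ ∫ x in Ω'', φ x • v x = ∫ x, φ x • v x := fun h'' =>
    ⟨setIntegral_eq_integral_of_forall_compl_eq_zero fun x hx => by
      rw [(hz x fun h => hx (h'' h)).2, zero_smul],
    setIntegral_eq_integral_of_forall_compl_eq_zero fun x hx => by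
      rw [(hz x fun h => hx (h'' h)).1, zero_smul]⟩
  have := h.2 φ hφ hc (hs.trans hΩ)
  rw [(e hΩ).1, (e hΩ).2] at this
  rw [(e subset_rfl).1, (e subset_rfl).2, this]

theorem integrableOn_test_smul {Ω : Set Plane} {v : Plane → Spinor}
    (hv : MemLp v 2 (volume.restrict Ω)) {φ : Plane → ℝ} (hφ : Continuous φ)
    (hc : HasCompactSupport φ) : IntegrableOn (fun x => φ x • v x) Ω :=
  memLp_one_iff_integrable.1
    (hv.smul ((hφ.memLp_of_hasCompactSupport (μ := volume) (p := 2) hc).restrict Ω))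

theorem IsWeakPartial.ae_eq {Ω : Set Plane} (hΩ : IsOpen Ω) {j : Fin 2} {u v w : Plane → Spinor}
    (hv : IsWeakPartial Ω j u v) (hw : IsWeakPartial Ω j u w) : v =ᵐ[volume.restrict Ω] w := by
  have hd : MemLp (fun x => v x - w x) 2 (volume.restrict Ω) := hv.1.sub hw.1
  have hloc : LocallyIntegrableOn (fun x => v x - w x) Ω := by
    rw [locallyIntegrableOn_iff hΩ.isLocallyClosed]
    intro K hK hKc
    have : Fact (volume K < ⊤) := ⟨hKc.measure_lt_top⟩
    exact (hd.mono_measure (Measure.restrict_mono hK le_rfl)).integrable (by norm_num)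
  have := hΩ.ae_eq_zero_of_integral_contDiff_smul_eq_zero hloc fun φ hφ hc hs => by
    rw [← setIntegral_eq_integral_of_forall_compl_eq_zero (s := Ω) fun x hx => by
      rw [image_eq_zero_of_notMem_tsupport fun h => hx (hs h), zero_smul]]
    simp only [smul_sub]
    rw [integral_sub (integrableOn_test_smul hv.1 hφ.continuous hc)
      (integrableOn_test_smul hw.1 hφ.continuous hc), sub_eq_zero, ← neg_inj,
      ← hv.2 φ hφ hc hs, ← hw.2 φ hφ hc hs]
  rw [Filter.EventuallyEq, ae_restrict_iff' hΩ.measurableSet]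
  filter_upwards [this] with x hx hxΩ
  exact sub_eq_zero.1 (hx hxΩ)

theorem sectorBetween_mono {α β α' β' : ℝ} (hα : α' ≤ α) (hβ : β ≤ β') :
    sectorBetween α β ⊆ sectorBetween α' β' := by
  rintro x ⟨r, θ, hr, h1, h2, h⟩
  exact ⟨r, θ, hr, hα.trans_lt h1, h2.trans_le hβ, h⟩

/-- The weak derivative on a subsector is the restriction of the one on the sector. -/
theorem weakPartial_subsector_ae_eq {α β ω : ℝ} (hα : 0 ≤ α) (hβ : β ≤ ω)
    (hω : ω ≤ 2 * Real.pi) {u : Plane → Spinor} (hu : MemH1 (sector ω) u) (j : Fin 2) :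
    weakPartial (sectorBetween α β) j u =ᵐ[volume.restrict (sectorBetween α β)]
      weakPartial (sector ω) j u := by
  have h1 : IsWeakPartial (sectorBetween α β) j u (weakPartial (sector ω) j u) :=
    (hu.isWeakPartial j).mono (sectorBetween_mono hα hβ)
  have h2 : IsWeakPartial (sectorBetween α β) j u (weakPartial (sectorBetween α β) j u) := by
    have hex : ∃ v, IsWeakPartial (sectorBetween α β) j u v := ⟨_, h1⟩
    rw [weakPartial, dif_pos hex]
    exact hex.choose_spec
  exact h2.ae_eq (isOpen_sectorBetween hα (hβ.trans hω)) h1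

/-! ### Weak differentiation on the whole sector -/

theorem IsTest.integrable_smul_memLp {χ : ℝ → ℝ} (h : IsTest χ) {E : ℝ → ℂ} (hE : Continuous E)
    {α β : ℝ} {f : ℝ × ℝ → Spinor} (hf : MemLp f 2 (polarMeasure α β)) :
    Integrable (fun q : ℝ × ℝ => ((χ q.1 : ℂ) * E q.2) • f q) (polarMeasure α β) :=
  memLp_one_iff_integrable.1 (hf.smul (h.memLp_mul hE α β))

theorem polarMeasure_split {ω : ℝ} (hω : 0 < ω) :
    polarMeasure 0 ω = polarMeasure 0 (ω / 2) + polarMeasure (ω / 2) ω := by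
  have : arc 0 ω = arc 0 (ω / 2) + arc (ω / 2) ω := by
    rw [arc, arc, arc, restrict_Ioo_eq_restrict_Ioc, restrict_Ioo_eq_restrict_Ioc,
      restrict_Ioo_eq_restrict_Ioc,
      ← Ioc_union_Ioc_eq_Ioc (show (0 : ℝ) ≤ ω / 2 by linarith) (show ω / 2 ≤ ω by linarith),
      Measure.restrict_union (Ioc_disjoint_Ioc_of_le le_rfl) measurableSet_Ioc]
  rw [polarMeasure, this, Measure.prod_add]

theorem integral_polarMeasure_split {ω : ℝ} (hω : 0 < ω) {f : ℝ × ℝ → Spinor}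
    (hf : Integrable f (polarMeasure 0 ω)) :
    ∫ q, f q ∂(polarMeasure 0 ω) =
      ∫ q, f q ∂(polarMeasure 0 (ω / 2)) + ∫ q, f q ∂(polarMeasure (ω / 2) ω) := by
  rw [polarMeasure_split hω] at hf ⊢
  exact integral_add_measure hf.left_of_add_measure hf.right_of_add_measure

/-- The weak form of `∂_θ` on `(α, β)`, tested against `χ(r) E(θ)`. -/
noncomputable def angularForm (α β : ℝ) (u : Plane → Spinor) (v : Fin 2 → Plane → Spinor)
    (χ : ℝ → ℝ) (E : ℝ → ℂ) : Spinor :=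
  ∫ q, ((χ q.1 : ℂ) * deriv E q.2) • u (polar q) ∂(polarMeasure α β) +
    ∫ q, ((q.1 * χ q.1 : ℝ) * E q.2) • angularPart v q ∂(polarMeasure α β)

/-- The weak form of `∂_r` on `(α, β)`, tested against `χ(r) E(θ)`. -/
noncomputable def radialForm (α β : ℝ) (u : Plane → Spinor) (v : Fin 2 → Plane → Spinor)
    (χ : ℝ → ℝ) (E : ℝ → ℂ) : Spinor :=
  ∫ q, ((deriv χ q.1 / q.1 : ℝ) * E q.2) • u (polar q) ∂(polarMeasure α β) +
    ∫ q, ((χ q.1 / q.1 : ℝ) * E q.2) • radialPart v q ∂(polarMeasure α β)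

section forms

variable {α β : ℝ} {u : Plane → Spinor} {v w : Fin 2 → Plane → Spinor} {χ : ℝ → ℝ} {E F : ℝ → ℂ}

theorem angularForm_add (hα : 0 ≤ α) (hβ : β ≤ 2 * Real.pi)
    (hu : MemLp u 2 (volume.restrict (sectorBetween α β)))
    (hv : ∀ j, MemLp (v j) 2 (volume.restrict (sectorBetween α β)))
    (hχ : IsTest χ) (hE : ContDiff ℝ 1 E) (hF : ContDiff ℝ 1 F) :
    angularForm α β u v χ (fun θ => E θ + F θ) =
      angularForm α β u v χ E + angularForm α β u v χ F := by
  have hd : ∀ θ, deriv (fun θ => E θ + F θ) θ = deriv E θ + deriv F θ := fun θ =>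
    deriv_fun_add (hE.differentiable (by simp) θ) (hF.differentiable (by simp) θ)
  have hu' := memLp_comp_polar hα hβ hu
  have ha := memLp_angularPart hα hβ hv
  simp only [angularForm, hd, mul_add, add_smul]
  rw [integral_add (hχ.integrable_smul_memLp (hE.continuous_deriv le_rfl) hu')
    (hχ.integrable_smul_memLp (hF.continuous_deriv le_rfl) hu'),
    integral_add (hχ.id_mul.integrable_smul_memLp hE.continuous ha)
    (hχ.id_mul.integrable_smul_memLp hF.continuous ha)]
  abel

theorem angularForm_const_mul (c : ℂ) (hE : Differentiable ℝ E) :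
    angularForm α β u v χ (fun θ => c * E θ) = c • angularForm α β u v χ E := by
  have hd : ∀ θ, deriv (fun θ => c * E θ) θ = c * deriv E θ := fun θ =>
    deriv_const_mul c (hE θ)
  simp only [angularForm, hd, mul_left_comm _ c, mul_smul c]
  rw [integral_smul, integral_smul, smul_add]

theorem ae_polarMeasure_congr (hα : 0 ≤ α) (hβ : β ≤ 2 * Real.pi)
    (h : ∀ j, v j =ᵐ[volume.restrict (sectorBetween α β)] w j) :
    ∀ᵐ q ∂(polarMeasure α β), ∀ j, v j (polar q) = w j (polar q) := by
  rw [ae_all_iff]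
  exact fun j => (measurePreserving_polar hα hβ).quasiMeasurePreserving.ae (h j)

theorem angularForm_congr (hα : 0 ≤ α) (hβ : β ≤ 2 * Real.pi)
    (h : ∀ j, v j =ᵐ[volume.restrict (sectorBetween α β)] w j) :
    angularForm α β u v χ E = angularForm α β u w χ E := by
  unfold angularForm
  congr 1
  refine integral_congr_ae ?_
  filter_upwards [ae_polarMeasure_congr hα hβ h] with q hq
  simp only [angularPart, hq]

theorem radialForm_congr (hα : 0 ≤ α) (hβ : β ≤ 2 * Real.pi)
    (h : ∀ j, v j =ᵐ[volume.restrict (sectorBetween α β)] w j) :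
    radialForm α β u v χ E = radialForm α β u w χ E := by
  unfold radialForm
  congr 1
  refine integral_congr_ae ?_
  filter_upwards [ae_polarMeasure_congr hα hβ h] with q hq
  simp only [radialPart, hq]

theorem angularForm_eq_zero_of_eqOn (hE : ∀ θ ∈ Ioo α β, E θ = 0) :
    angularForm α β u v χ E = 0 := by
  have h0 : ∀ᵐ q ∂(polarMeasure α β), E q.2 = 0 ∧ deriv E q.2 = 0 := by
    filter_upwards [ae_polarMeasure α β] with q hq
    refine ⟨hE _ hq.2, ?_⟩
    have : E =ᶠ[𝓝 q.2] fun _ => 0 := by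
      filter_upwards [isOpen_Ioo.mem_nhds hq.2] with t ht using hE t ht
    rw [this.deriv_eq, deriv_const]
  unfold angularForm
  rw [integral_eq_zero_of_ae, integral_eq_zero_of_ae, add_zero]
  · filter_upwards [h0] with q hq
    simp [hq.1]
  · filter_upwards [h0] with q hq
    simp [hq.2]

end forms

theorem angularForm_interior {α β a b : ℝ} (hα : 0 ≤ α) (hβ : β ≤ 2 * Real.pi)
    (ha : α < a) (hb : b < β) {u : Plane → Spinor} {v : Fin 2 → Plane → Spinor}
    (hu : MemLp u 2 (volume.restrict (sectorBetween α β)))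
    (hv : ∀ j, IsWeakPartial (sectorBetween α β) j u (v j)) {χ : ℝ → ℝ} {E : ℝ → ℂ}
    (hχ : IsTest χ) (hE : ContDiff ℝ (⊤ : ℕ∞) E) (hEz : ∀ θ, θ ∉ Icc a b → E θ = 0) :
    angularForm α β u v χ E = 0 := by
  have real : ∀ η : ℝ → ℝ, ContDiff ℝ (⊤ : ℕ∞) η → (∀ θ, θ ∉ Icc a b → η θ = 0) →
      angularForm α β u v χ (fun θ => (η θ : ℂ)) = 0 := fun η hη hηz => by
    have hηc : Continuous fun θ => (η θ : ℂ) := Complex.continuous_ofReal.comp hη.continuous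
    have hηc' : Continuous fun θ => ((deriv η θ : ℝ) : ℂ) :=
      Complex.continuous_ofReal.comp (hη.continuous_deriv (by simp))
    have hd : ∀ θ, deriv (fun θ => (η θ : ℂ)) θ = ((deriv η θ : ℝ) : ℂ) := fun θ =>
      ((hη.differentiable (by simp)) θ).hasDerivAt.ofReal_comp.deriv
    simp only [angularForm, hd]
    rw [← integral_add (hχ.integrable_smul_memLp hηc' (memLp_comp_polar hα hβ hu))
      (hχ.id_mul.integrable_smul_memLp hηc (memLp_angularPart hα hβ fun j => (hv j).1)),
      ← integral_angular_interior_real hα hβ ha hb hu hv hχ hη hηz]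
    refine integral_congr_ae (Eventually.of_forall fun q => ?_)
    simp only [← Complex.ofReal_mul, Complex.coe_smul]
  have hre : ContDiff ℝ (⊤ : ℕ∞) fun θ => (E θ).re := Complex.reCLM.contDiff.comp hE
  have him : ContDiff ℝ (⊤ : ℕ∞) fun θ => (E θ).im := Complex.imCLM.contDiff.comp hE
  have hre' : ContDiff ℝ 1 fun θ => ((E θ).re : ℂ) :=
    (Complex.ofRealCLM.contDiff.comp hre).of_le (by exact_mod_cast le_top)
  have him' : ContDiff ℝ 1 fun θ => ((E θ).im : ℂ) :=
    (Complex.ofRealCLM.contDiff.comp him).of_le (by exact_mod_cast le_top)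
  have hsplit : E = fun θ => ((E θ).re : ℂ) + Complex.I * ((E θ).im : ℂ) := by
    ext θ
    rw [mul_comm, Complex.re_add_im]
  rw [hsplit, angularForm_add hα hβ hu (fun j => (hv j).1) hχ hre' (contDiff_const.mul him'),
    angularForm_const_mul _ (him'.differentiable (by simp)),
    real _ hre fun θ hθ => by rw [hEz θ hθ, Complex.zero_re],
    real _ him fun θ hθ => by rw [hEz θ hθ, Complex.zero_im], smul_zero, add_zero]

section sector

variable {ω : ℝ} {u : Plane → Spinor} {χ : ℝ → ℝ} {E : ℝ → ℂ} {g₀ g₁ : ℝ → Spinor}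

theorem radialForm_sector (hω0 : 0 < ω) (hω : ω ≤ 2 * Real.pi) (hu : MemH1 (sector ω) u)
    (h₀ : IsEdgeTrace (sectorBetween 0 (ω / 2)) 0 u g₀)
    (h₁ : IsEdgeTrace (sectorBetween (ω / 2) ω) ω u g₁) (hχ : IsTest χ) (hE : Continuous E) :
    radialForm 0 ω u (fun j => weakPartial (sector ω) j u) χ E = 0 := by
  have hsub : ∀ {α β : ℝ} {θ₀ : ℝ} {g : ℝ → Spinor}, 0 ≤ α → β ≤ ω →
      IsEdgeTrace (sectorBetween α β) θ₀ u g →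
      radialForm α β u (fun j => weakPartial (sector ω) j u) χ E = 0 := by
    intro α β θ₀ g hα hβ ht
    have hae := weakPartial_subsector_ae_eq hα hβ hω hu
    have hle : volume.restrict (sectorBetween α β) ≤ volume.restrict (sector ω) :=
      Measure.restrict_mono (sectorBetween_mono hα hβ) le_rfl
    rw [← radialForm_congr hα (hβ.trans hω) hae]
    exact integral_radial_of_isEdgeTrace hα (hβ.trans hω) ht (hu.1.mono_measure hle)
      (fun j => ((hu.isWeakPartial j).1.mono_measure hle).ae_eq (hae j).symm) hχ hE
  have hu' := memLp_comp_polar le_rfl hω hu.1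
  have hr := memLp_radialPart le_rfl hω fun j => (hu.isWeakPartial j).1
  have e1 := hsub le_rfl (by linarith) h₀
  have e2 := hsub (by linarith) le_rfl h₁
  unfold radialForm at e1 e2 ⊢
  rw [integral_polarMeasure_split hω0 (hχ.deriv.div_id.integrable_smul_memLp hE hu'),
    integral_polarMeasure_split hω0 (hχ.div_id.integrable_smul_memLp hE hr),
    add_add_add_comm, e1, e2, add_zero]

theorem angularForm_split (hω0 : 0 < ω) (hω : ω ≤ 2 * Real.pi) (hu : MemH1 (sector ω) u)
    (hχ : IsTest χ) (hE : ContDiff ℝ 1 E) :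
    angularForm 0 ω u (fun j => weakPartial (sector ω) j u) χ E =
      angularForm 0 (ω / 2) u (fun j => weakPartial (sector ω) j u) χ E +
      angularForm (ω / 2) ω u (fun j => weakPartial (sector ω) j u) χ E := by
  have hu' := memLp_comp_polar le_rfl hω hu.1
  have hr := memLp_angularPart le_rfl hω fun j => (hu.isWeakPartial j).1
  unfold angularForm
  rw [integral_polarMeasure_split hω0
      (hχ.integrable_smul_memLp (hE.continuous_deriv le_rfl) hu'),
    integral_polarMeasure_split hω0 (hχ.id_mul.integrable_smul_memLp hE.continuous hr),
    add_add_add_comm]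

theorem angularForm_edge {α β θ₀ : ℝ} (hα : 0 ≤ α) (hαβ : α ≤ β) (hβ : β ≤ ω)
    (hω : ω ≤ 2 * Real.pi) (hu : MemH1 (sector ω) u) {g : ℝ → Spinor}
    (ht : IsEdgeTrace (sectorBetween α β) θ₀ u g) (hχ : IsTest χ) (hE : ContDiff ℝ 1 E) {s : ℂ}
    (hs : ∀ f : ℝ → Spinor, E β • f β - E α • f α = s • f θ₀) :
    angularForm α β u (fun j => weakPartial (sector ω) j u) χ E =
      ∫ r in Ioi 0, ((r * χ r : ℝ) * s) • g r := by
  have hae := weakPartial_subsector_ae_eq hα hβ hω hu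
  have hle : volume.restrict (sectorBetween α β) ≤ volume.restrict (sector ω) :=
    Measure.restrict_mono (sectorBetween_mono hα hβ) le_rfl
  rw [← angularForm_congr hα (hβ.trans hω) hae]
  exact integral_angular_of_isEdgeTrace hα hαβ (hβ.trans hω) ht (hu.1.mono_measure hle)
    (fun j => ((hu.isWeakPartial j).1.mono_measure hle).ae_eq (hae j).symm) hχ hE hs

/-- Weak differentiation in the angular direction on the whole sector, with the traces on both
edges as boundary terms. A partition of unity in `θ` reduces this to functions supported near one
edge, where the approximating smooth functions give the trace, and to functions supported in the
interior, where the definition of the weak derivative applies. -/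
theorem angularForm_sector (hω0 : 0 < ω) (hω : ω ≤ 2 * Real.pi) (hu : MemH1 (sector ω) u)
    (h₀ : IsEdgeTrace (sectorBetween 0 (ω / 2)) 0 u g₀)
    (h₁ : IsEdgeTrace (sectorBetween (ω / 2) ω) ω u g₁) (hχ : IsTest χ)
    (hE : ContDiff ℝ (⊤ : ℕ∞) E) :
    angularForm 0 ω u (fun j => weakPartial (sector ω) j u) χ E =
      (∫ r in Ioi 0, ((r * χ r : ℝ) * E ω) • g₁ r) +
        ∫ r in Ioi 0, ((r * χ r : ℝ) * -E 0) • g₀ r := by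
  -- `η₀` is `1` near `0` and `0` beyond `ω / 4`; `η₁` is `0` up to `3ω / 4` and `1` near `ω`.
  set η₀ : ℝ → ℂ := fun θ => 1 - (Real.smoothTransition (8 / ω * θ - 1) : ℂ) with hη₀
  set η₁ : ℝ → ℂ := fun θ => (Real.smoothTransition (8 / ω * θ - 6) : ℂ) with hη₁
  have s₁ : ∀ c : ℝ, ContDiff ℝ (⊤ : ℕ∞) fun θ : ℝ =>
      (Real.smoothTransition (8 / ω * θ - c) : ℂ) := fun c =>
    Complex.ofRealCLM.contDiff.comp (Real.smoothTransition.contDiff.comp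
      ((contDiff_const.mul contDiff_id).sub contDiff_const))
  have c₀ : ContDiff ℝ (⊤ : ℕ∞) η₀ := contDiff_const.sub (s₁ 1)
  have c₁ : ContDiff ℝ (⊤ : ℕ∞) η₁ := s₁ 6
  have le : ∀ {θ t : ℝ}, 8 / ω * θ ≤ t ↔ θ ≤ t * ω / 8 := fun {θ t} => by
    rw [div_mul_eq_mul_div, div_le_iff₀ hω0, le_div_iff₀ (by norm_num), mul_comm θ]
  have ge : ∀ {θ t : ℝ}, t ≤ 8 / ω * θ ↔ t * ω / 8 ≤ θ := fun {θ t} => by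
    rw [div_mul_eq_mul_div, le_div_iff₀ hω0, div_le_iff₀ (by norm_num), mul_comm θ]
  have z₀ : ∀ θ, ω / 4 ≤ θ → η₀ θ = 0 := fun θ h => by
    have : 2 ≤ 8 / ω * θ := ge.2 (by linarith)
    simp only [hη₀]
    rw [Real.smoothTransition.one_of_one_le (by linarith)]
    simp
  have o₀ : ∀ θ, θ ≤ ω / 8 → η₀ θ = 1 := fun θ h => by
    have : 8 / ω * θ ≤ 1 := le.2 (by linarith)
    simp only [hη₀]
    rw [Real.smoothTransition.zero_of_nonpos (by linarith)]
    simp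
  have z₁ : ∀ θ, θ ≤ 3 * ω / 4 → η₁ θ = 0 := fun θ h => by
    have : 8 / ω * θ ≤ 6 := le.2 (by linarith)
    simp only [hη₁]
    rw [Real.smoothTransition.zero_of_nonpos (by linarith)]
    simp
  have o₁ : ∀ θ, 7 * ω / 8 ≤ θ → η₁ θ = 1 := fun θ h => by
    have : 7 ≤ 8 / ω * θ := ge.2 (by linarith)
    simp only [hη₁]
    rw [Real.smoothTransition.one_of_one_le (by linarith)]
    simp
  have top1 : ∀ {F : ℝ → ℂ}, ContDiff ℝ (⊤ : ℕ∞) F → ContDiff ℝ 1 F := fun h =>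
    h.of_le (by exact_mod_cast le_top)
  have C₀ : ContDiff ℝ (⊤ : ℕ∞) fun θ => E θ * η₀ θ := hE.mul c₀
  have C₁ : ContDiff ℝ (⊤ : ℕ∞) fun θ => E θ * η₁ θ := hE.mul c₁
  have C₂ : ContDiff ℝ (⊤ : ℕ∞) fun θ => E θ * (1 - η₀ θ - η₁ θ) :=
    hE.mul ((contDiff_const.sub c₀).sub c₁)
  have hsplit : E = fun θ => (E θ * η₀ θ + E θ * η₁ θ) + E θ * (1 - η₀ θ - η₁ θ) := by
    ext θ; ring
  have hv := fun j => (hu.isWeakPartial j)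
  conv_lhs => rw [hsplit]
  rw [angularForm_add le_rfl hω hu.1 (fun j => (hv j).1) hχ (top1 (C₀.add C₁)) (top1 C₂),
    angularForm_add le_rfl hω hu.1 (fun j => (hv j).1) hχ (top1 C₀) (top1 C₁),
    angularForm_interior le_rfl hω (a := ω / 8) (b := 7 * ω / 8) (by linarith) (by linarith) hu.1
      hv hχ C₂ fun θ hθ => ?_,
    angularForm_split hω0 hω hu hχ (top1 C₀), angularForm_split hω0 hω hu hχ (top1 C₁),
    angularForm_eq_zero_of_eqOn (α := ω / 2) (E := fun θ => E θ * η₀ θ) fun θ hθ => by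
      rw [z₀ θ (by linarith [hθ.1]), mul_zero],
    angularForm_eq_zero_of_eqOn (α := 0) (E := fun θ => E θ * η₁ θ) fun θ hθ => by
      rw [z₁ θ (by linarith [hθ.2]), mul_zero],
    angularForm_edge (s := -E 0) le_rfl (by linarith) (by linarith) hω hu h₀ hχ (top1 C₀) fun f => by
      rw [z₀ (ω / 2) (by linarith), o₀ 0 (by linarith)]; simp,
    angularForm_edge (s := E ω) (by linarith) (by linarith) le_rfl hω hu h₁ hχ (top1 C₁) fun f => by
      rw [z₁ (ω / 2) (by linarith), o₁ ω (by linarith)]; simp]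
  · abel
  · rcases lt_or_ge θ (ω / 8) with h | h
    · rw [o₀ θ h.le, z₁ θ (by linarith)]; ring
    · have h' : 7 * ω / 8 < θ := by by_contra hc; exact hθ ⟨h, not_lt.1 hc⟩
      rw [z₀ θ (by linarith), o₁ θ h'.le]; ring

end sector

/-! ### Angular modes of functions on the sector -/

/-- The pairing, as a function of `r`, of `f` with the angular mode of frequency `μ`. -/
noncomputable def radialMode (ω μ : ℝ) (f : ℝ × ℝ → Spinor) (r : ℝ) : ℂ :=
  mode ω μ (fun θ => f (r, θ) 0) (fun θ => f (r, θ) 1)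

theorem memLp_component {X : Type*} [MeasurableSpace X] {m : Measure X} {f : X → Spinor}
    (hf : MemLp f 2 m) (i : Fin 2) : MemLp (fun x => f x i) 2 m :=
  (EuclideanSpace.proj i : Spinor →L[ℂ] ℂ).comp_memLp' hf

theorem ae_memLp_slice {ω : ℝ} {f : ℝ × ℝ → Spinor} (hf : MemLp f 2 (polarMeasure 0 ω)) :
    ∀ᵐ r ∂radialMeasure, ∀ i, MemLp (fun θ => f (r, θ) i) 2 (arc 0 ω) := by
  have hs := (memLp_two_iff_integrable_sq_norm hf.1).1 hf
  filter_upwards [hs.prod_right_ae, hf.1.prodMk_left] with r h1 h2 i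
  exact memLp_component ((memLp_two_iff_integrable_sq_norm h2).2 h1) i

theorem spinor_norm_sq (x : Spinor) : ‖x‖ ^ 2 = ‖x 0‖ ^ 2 + ‖x 1‖ ^ 2 := by
  rw [EuclideanSpace.norm_sq_eq, Fin.sum_univ_two]

theorem ae_tsum_radialMode {ω : ℝ} (hω : 0 < ω) {f : ℝ × ℝ → Spinor}
    (hf : MemLp f 2 (polarMeasure 0 ω)) :
    ∀ᵐ r ∂radialMeasure, ∑' k : ℤ, ENNReal.ofReal (‖radialMode ω (freq ω k) f r‖ ^ 2) =
      ENNReal.ofReal (2 * ω) * ∫⁻ θ, ENNReal.ofReal (‖f (r, θ)‖ ^ 2) ∂(arc 0 ω) := by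
  filter_upwards [ae_memLp_slice hf] with r hr
  simp only [spinor_norm_sq]
  exact tsum_norm_mode_sq hω (hr 0) (hr 1)

theorem aestronglyMeasurable_radialMode {ω μ : ℝ} {f : ℝ × ℝ → Spinor}
    (hf : MemLp f 2 (polarMeasure 0 ω)) :
    AEStronglyMeasurable (radialMode ω μ f) radialMeasure := by
  have hp : ∀ ν, AEStronglyMeasurable (fun q : ℝ × ℝ => phase ν q.2) (polarMeasure 0 ω) :=
    fun ν => ((continuous_phase ν).comp continuous_snd).aestronglyMeasurable
  exact AEStronglyMeasurable.integral_prod_right'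
    (f := fun q : ℝ × ℝ => phase μ q.2 * f q 0 + phase (-μ) q.2 * f q 1)
    (((hp μ).mul (memLp_component hf 0).1).add ((hp (-μ)).mul (memLp_component hf 1).1))

theorem lintegral_sq_lt_top {X : Type*} [MeasurableSpace X] {m : Measure X} {f : X → Spinor}
    (hf : MemLp f 2 m) : ∫⁻ x, ENNReal.ofReal (‖f x‖ ^ 2) ∂m < ⊤ :=
  ((memLp_two_iff_integrable_sq_norm hf.1).1 hf).lintegral_lt_top

theorem aemeasurable_ofReal_sq {X F : Type*} [MeasurableSpace X] {m : Measure X}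
    [NormedAddCommGroup F] {f : X → F}
    (hf : AEStronglyMeasurable f m) : AEMeasurable (fun x => ENNReal.ofReal (‖f x‖ ^ 2)) m :=
  (hf.norm.pow 2).aemeasurable.ennreal_ofReal

theorem memLp_radialMode {ω : ℝ} (hω : 0 < ω) (k : ℤ) {f : ℝ × ℝ → Spinor}
    (hf : MemLp f 2 (polarMeasure 0 ω)) : MemLp (radialMode ω (freq ω k) f) 2 radialMeasure := by
  have hm := aestronglyMeasurable_radialMode (μ := freq ω k) hf
  rw [memLp_two_iff_integrable_sq_norm hm]
  refine ⟨hm.norm.pow 2, ?_⟩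
  rw [hasFiniteIntegral_iff_ofReal (Eventually.of_forall fun r => by positivity)]
  calc ∫⁻ r, ENNReal.ofReal (‖radialMode ω (freq ω k) f r‖ ^ 2) ∂radialMeasure
      ≤ ∫⁻ r, ENNReal.ofReal (2 * ω) *
          ∫⁻ θ, ENNReal.ofReal (‖f (r, θ)‖ ^ 2) ∂(arc 0 ω) ∂radialMeasure := by
        refine lintegral_mono_ae ?_
        filter_upwards [ae_tsum_radialMode hω hf] with r hr
        rw [← hr]
        exact ENNReal.le_tsum k
    _ < ⊤ := by
        rw [lintegral_const_mul' _ _ ENNReal.ofReal_ne_top,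
          ← lintegral_prod _ (aemeasurable_ofReal_sq hf.1)]
        exact ENNReal.mul_lt_top ENNReal.ofReal_lt_top (lintegral_sq_lt_top hf)

theorem radialMode_add_ae {ω μ : ℝ} {f g : ℝ × ℝ → Spinor}
    (hf : MemLp f 2 (polarMeasure 0 ω)) (hg : MemLp g 2 (polarMeasure 0 ω)) :
    ∀ᵐ r ∂radialMeasure, radialMode ω μ (fun q => f q + g q) r =
      radialMode ω μ f r + radialMode ω μ g r := by
  filter_upwards [ae_memLp_slice hf, ae_memLp_slice hg] with r h1 h2
  rw [radialMode, radialMode, radialMode, mode, mode, mode,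
    ← integral_add (integrable_mode (h1 0) (h1 1)) (integrable_mode (h2 0) (h2 1))]
  refine integral_congr_ae (Eventually.of_forall fun θ => ?_)
  simp only [PiLp.add_apply]
  ring

/-- Fubini's theorem for the weak forms: testing against `a(r) e^{±iμθ}` amounts to testing the
angular mode against `a`. -/
theorem integral_mul_radialMode {ω μ : ℝ} {f : ℝ × ℝ → Spinor}
    (hf : MemLp f 2 (polarMeasure 0 ω)) {a : ℝ → ℝ} (ha : IsTest a) :
    ∫ r in Ioi 0, (r * a r) • radialMode ω μ f r =
      (∫ q, ((a q.1 : ℂ) * phase μ q.2) • f q ∂(polarMeasure 0 ω)) 0 +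
      (∫ q, ((a q.1 : ℂ) * phase (-μ) q.2) • f q ∂(polarMeasure 0 ω)) 1 := by
  have hcomp : ∀ (ν : ℝ) (i : Fin 2),
      Integrable (fun q : ℝ × ℝ => (a q.1 : ℂ) * (phase ν q.2 * f q i)) (polarMeasure 0 ω) ∧
      (∫ q, ((a q.1 : ℂ) * phase ν q.2) • f q ∂(polarMeasure 0 ω)) i =
        ∫ q : ℝ × ℝ, (a q.1 : ℂ) * (phase ν q.2 * f q i) ∂(polarMeasure 0 ω) := fun ν i => by
    have hi := ha.integrable_smul_memLp (continuous_phase ν) hf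
    have h1 := (EuclideanSpace.proj i : Spinor →L[ℂ] ℂ).integral_comp_comm hi
    have h2 := (EuclideanSpace.proj i : Spinor →L[ℂ] ℂ).integrable_comp hi
    simp only [PiLp.proj_apply, PiLp.smul_apply, smul_eq_mul, mul_assoc] at h1 h2
    exact ⟨h2, by simpa only [mul_assoc] using h1.symm⟩
  obtain ⟨i0, e0⟩ := hcomp μ 0
  obtain ⟨i1, e1⟩ := hcomp (-μ) 1
  rw [e0, e1, ← integral_add i0 i1]
  refine Eq.trans ?_ (integral_prod _ (i0.add i1)).symm
  have hr := integral_radialMeasure fun r => a r • radialMode ω μ f r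
  simp only [smul_smul] at hr
  rw [← hr]
  refine integral_congr_ae (Eventually.of_forall fun r => ?_)
  simp only [Pi.add_apply]
  rw [radialMode, mode, ← integral_smul]
  refine integral_congr_ae (Eventually.of_forall fun θ => ?_)
  simp only [Complex.real_smul]
  ring

/-! ### The boundary condition and the equation for the modes -/

theorem component_one_of_boundary {n : Plane} {g : Spinor} (h : act (boundaryMatrix n) g = g) :
    g 1 = Complex.I * (n 0 + n 1 * Complex.I) * g 0 := by
  have := congrArg (fun x : Spinor => x 1) h
  simp [act, boundaryMatrix, sigmaDot, σ₁, σ₂, σ₃, dotProduct,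
    Fin.sum_univ_two] at this
  rw [← this]
  ring

/-- The pointwise action of `i σ₃`. -/
noncomputable def twist (f : ℝ × ℝ → Spinor) (q : ℝ × ℝ) : Spinor :=
  !₂[Complex.I * f q 0, -Complex.I * f q 1]

/-- The operator `∂_r + (i σ₃ / r) ∂_θ`. It equals `σ · ∇` with the two components of the result
swapped and multiplied by `e^{-iθ}` and `e^{iθ}`, see `norm_rotatedDirac_sq`. -/
noncomputable def rotatedDirac (v : Fin 2 → Plane → Spinor) (q : ℝ × ℝ) : Spinor :=
  radialPart v q + twist (angularPart v) q

theorem memLp_twist {X : Measure (ℝ × ℝ)} {f : ℝ × ℝ → Spinor} (hf : MemLp f 2 X) :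
    MemLp (twist f) 2 X := by
  rw [memLp_piLp_iff]
  intro i
  fin_cases i
  · exact (memLp_component hf 0).const_mul Complex.I
  · exact (memLp_component hf 1).const_mul (-Complex.I)

theorem norm_rotatedDirac_sq (v : Fin 2 → Plane → Spinor) (q : ℝ × ℝ) :
    ‖rotatedDirac v q‖ ^ 2 = ‖act σ₁ (v 0 (polar q)) + act σ₂ (v 1 (polar q))‖ ^ 2 := by
  have hc : Complex.exp (-(q.2 * Complex.I)) = Complex.cos q.2 - Complex.sin q.2 * Complex.I := by
    rw [← neg_mul, Complex.exp_mul_I, Complex.cos_neg, Complex.sin_neg]; ring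
  have hc' : Complex.exp (q.2 * Complex.I) = Complex.cos q.2 + Complex.sin q.2 * Complex.I := by
    rw [Complex.exp_mul_I]
  have n1 : ‖Complex.exp (q.2 * Complex.I)‖ = 1 := Complex.norm_exp_ofReal_mul_I _
  have n2 : ‖Complex.exp (-(q.2 * Complex.I))‖ = 1 := by
    rw [← neg_mul, ← Complex.ofReal_neg]; exact Complex.norm_exp_ofReal_mul_I _
  have e0 : rotatedDirac v q 0 = Complex.exp (-(q.2 * Complex.I)) *
      (v 0 (polar q) 0 + Complex.I * v 1 (polar q) 0) := by
    rw [hc]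
    simp [rotatedDirac, twist, radialPart, angularPart]
    linear_combination (Complex.sin q.2 * v 1 (polar q) 0) * Complex.I_sq
  have e1 : rotatedDirac v q 1 = Complex.exp (q.2 * Complex.I) *
      (v 0 (polar q) 1 - Complex.I * v 1 (polar q) 1) := by
    rw [hc']
    simp [rotatedDirac, twist, radialPart, angularPart]
    linear_combination (Complex.sin q.2 * v 1 (polar q) 1) * Complex.I_sq
  have f0 : (act σ₁ (v 0 (polar q)) + act σ₂ (v 1 (polar q))) 0 =
      v 0 (polar q) 1 - Complex.I * v 1 (polar q) 1 := by
    simp [act, σ₁, σ₂, dotProduct, Fin.sum_univ_two]; ring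
  have f1 : (act σ₁ (v 0 (polar q)) + act σ₂ (v 1 (polar q))) 1 =
      v 0 (polar q) 0 + Complex.I * v 1 (polar q) 0 := by
    simp [act, σ₁, σ₂, dotProduct, Fin.sum_univ_two]
  rw [spinor_norm_sq, spinor_norm_sq, e0, e1, f0, f1, norm_mul, norm_mul, n1, n2]
  ring

theorem hasDerivAt_phase (μ θ : ℝ) : HasDerivAt (phase μ) (Complex.I * μ * phase μ θ) θ := by
  have h1 : HasDerivAt (fun t : ℝ => Complex.I * ((μ * t : ℝ) : ℂ)) (Complex.I * μ) θ := by
    have := ((hasDerivAt_id θ).const_mul μ).ofReal_comp.const_mul Complex.I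
    simpa using this
  have h2 := h1.cexp
  rw [mul_comm] at h2
  exact h2

theorem contDiff_phase (μ : ℝ) : ContDiff ℝ (⊤ : ℕ∞) (phase μ) := by
  have : ContDiff ℝ (⊤ : ℕ∞) fun t : ℝ => Complex.I * ((μ * t : ℝ) : ℂ) :=
    contDiff_const.mul (Complex.ofRealCLM.contDiff.comp (contDiff_const.mul contDiff_id))
  exact this.cexp

section domain

variable {ω : ℝ} {ψ : Plane → Spinor} {g₀ g₁ : ℝ → Spinor}

/-- The angular modes of `∂_r ψ` are the weak derivatives of those of `ψ`. -/
theorem weakDeriv_radialMode (hω0 : 0 < ω) (hω : ω ≤ 2 * Real.pi) (hψ : MemH1 (sector ω) ψ)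
    (h₀ : IsEdgeTrace (sectorBetween 0 (ω / 2)) 0 ψ g₀)
    (h₁ : IsEdgeTrace (sectorBetween (ω / 2) ω) ω ψ g₁) (μ : ℝ) {χ : ℝ → ℝ} (hχ : IsTest χ) :
    ∫ r in Ioi 0, deriv χ r • radialMode ω μ (fun q => ψ (polar q)) r =
      -∫ r in Ioi 0, χ r • radialMode ω μ (radialPart fun j => weakPartial (sector ω) j ψ) r := by
  have hu := memLp_comp_polar le_rfl hω hψ.1
  have hr := memLp_radialPart le_rfl hω fun j => (hψ.isWeakPartial j).1
  have z : ∀ ν, radialForm 0 ω ψ (fun j => weakPartial (sector ω) j ψ) χ (phase ν) = 0 := fun ν =>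
    radialForm_sector hω0 hω hψ h₀ h₁ hχ (continuous_phase ν)
  have e0 := congrArg (fun x : Spinor => x 0) (z μ)
  have e1 := congrArg (fun x : Spinor => x 1) (z (-μ))
  simp only [radialForm, PiLp.add_apply, PiLp.zero_apply] at e0 e1
  have m1 := integral_mul_radialMode (μ := μ) hu hχ.deriv.div_id
  have m2 := integral_mul_radialMode (μ := μ) hr hχ.div_id
  have s : ∀ (a : ℝ → ℝ) (f : ℝ → ℂ), ∫ r in Ioi 0, (r * (a r / r)) • f r =
      ∫ r in Ioi 0, a r • f r := fun a f => by
    refine setIntegral_congr_fun measurableSet_Ioi fun r hr => ?_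
    have h0 : (0 : ℝ) < r := hr
    rw [mul_div_cancel₀ _ h0.ne']
  rw [s] at m1 m2
  rw [m1, m2]
  linear_combination e0 + e1

theorem integral_smul_component {f : ℝ → Spinor} {K : ℝ → ℂ}
    (h : Integrable (fun r => K r • f r) (volume.restrict (Ioi (0 : ℝ)))) (i : Fin 2) :
    (∫ r in Ioi 0, K r • f r) i = ∫ r in Ioi 0, K r * f r i := by
  have := (EuclideanSpace.proj i : Spinor →L[ℂ] ℂ).integral_comp_comm h
  simpa using this.symm

theorem integrable_edge {g : ℝ → Spinor} (hg : MemLp g 2 (volume.restrict (Ioi (0 : ℝ))))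
    {χ : ℝ → ℝ} (hχ : IsTest χ) (s : ℂ) :
    Integrable (fun r => ((χ r : ℂ) * s) • g r) (volume.restrict (Ioi (0 : ℝ))) := by
  have hc := hχ.contDiff.continuous
  have hcc : Continuous fun r : ℝ => (χ r : ℂ) * s := by fun_prop
  have hK : MemLp (fun r : ℝ => (χ r : ℂ) * s) 2 volume := by
    refine hcc.memLp_of_hasCompactSupport ?_
    refine hχ.compact.mono' (fun r hr => subset_tsupport _ fun h0 => hr ?_)
    change (χ r : ℂ) * s = 0
    rw [h0, Complex.ofReal_zero, zero_mul]
  exact memLp_one_iff_integrable.1 (hg.smul (hK.restrict _))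

/-- The angular modes of `i σ₃ ∂_θ ψ` are those of `ψ` multiplied by the frequency, in weak form:
the boundary terms cancel by the infinite mass condition. -/
theorem integral_mul_radialMode_twist (hω0 : 0 < ω) (hω : ω ≤ 2 * Real.pi)
    (hψ : MemH1 (sector ω) ψ)
    (h₀ : IsEdgeTrace (sectorBetween 0 (ω / 2)) 0 ψ g₀)
    (b₀ : ∀ᵐ r ∂(volume.restrict (Ioi (0 : ℝ))), act (boundaryMatrix (-eth 0)) (g₀ r) = g₀ r)
    (h₁ : IsEdgeTrace (sectorBetween (ω / 2) ω) ω ψ g₁)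
    (b₁ : ∀ᵐ r ∂(volume.restrict (Ioi (0 : ℝ))), act (boundaryMatrix (eth ω)) (g₁ r) = g₁ r)
    (k : ℤ) {χ : ℝ → ℝ} (hχ : IsTest χ) :
    ∫ r in Ioi 0, (r * (r * χ r)) • radialMode ω (freq ω k)
        (twist (angularPart fun j => weakPartial (sector ω) j ψ)) r =
      freq ω k * ∫ r in Ioi 0, (r * χ r) • radialMode ω (freq ω k) (fun q => ψ (polar q)) r := by
  set v : Fin 2 → Plane → Spinor := fun j => weakPartial (sector ω) j ψ with hv
  set μ := freq ω k with hμ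
  have hu := memLp_comp_polar le_rfl hω hψ.1
  have ha : MemLp (angularPart v) 2 (polarMeasure 0 ω) :=
    memLp_angularPart le_rfl hω fun j => (hψ.isWeakPartial j).1
  -- The boundary terms of the two components.
  have bd : ∀ (ν : ℝ) (i : Fin 2), angularForm 0 ω ψ v χ (phase ν) i =
      (∫ r in Ioi 0, (((r * χ r : ℝ) : ℂ) * phase ν ω) * g₁ r i) +
        ∫ r in Ioi 0, (((r * χ r : ℝ) : ℂ) * -phase ν 0) * g₀ r i := fun ν i => by
    rw [angularForm_sector hω0 hω hψ h₀ h₁ hχ (contDiff_phase ν), PiLp.add_apply,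
      integral_smul_component (integrable_edge h₁.1 hχ.id_mul _),
      integral_smul_component (integrable_edge h₀.1 hχ.id_mul _)]
  have p0 : ∀ ν, phase ν 0 = 1 := fun ν => by simp [phase]
  have bd0 : ∫ r in Ioi 0, (((r * χ r : ℝ) : ℂ) * -phase μ 0) * g₀ r 0 =
      ∫ r in Ioi 0, (((r * χ r : ℝ) : ℂ) * -phase (-μ) 0) * g₀ r 1 := by
    refine integral_congr_ae ?_
    filter_upwards [b₀] with r hr
    have := component_one_of_boundary hr
    simp [eth] at this
    rw [this, p0, p0]
  have bd1 : ∫ r in Ioi 0, (((r * χ r : ℝ) : ℂ) * phase μ ω) * g₁ r 0 =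
      ∫ r in Ioi 0, (((r * χ r : ℝ) : ℂ) * phase (-μ) ω) * g₁ r 1 := by
    refine integral_congr_ae ?_
    filter_upwards [b₁] with r hr
    have h1 := component_one_of_boundary hr
    have h2 : Complex.I * (((eth ω) 0 : ℝ) + ((eth ω) 1 : ℝ) * Complex.I) = -phase 1 ω := by
      rw [phase, one_mul, mul_comm Complex.I (ω : ℂ), Complex.exp_mul_I]
      simp [eth]
      linear_combination Complex.cos ω * Complex.I_sq
    rw [h1, h2, hμ, phase_freq hω0 k]
    ring
  have hbd : angularForm 0 ω ψ v χ (phase μ) 0 = angularForm 0 ω ψ v χ (phase (-μ)) 1 := by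
    rw [bd, bd, bd0, bd1]
  -- Both forms expressed through the modes.
  have hform : ∀ (ν : ℝ) (i : Fin 2), angularForm 0 ω ψ v χ (phase ν) i =
      Complex.I * ν * (∫ q, ((χ q.1 : ℂ) * phase ν q.2) • ψ (polar q) ∂(polarMeasure 0 ω)) i +
      (∫ q, (((q.1 * χ q.1 : ℝ) : ℂ) * phase ν q.2) • angularPart v q ∂(polarMeasure 0 ω)) i :=
    fun ν i => by
      have hd : ∀ θ, deriv (phase ν) θ = Complex.I * ν * phase ν θ := fun θ =>
        (hasDerivAt_phase ν θ).deriv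
      simp only [angularForm, hd, mul_left_comm _ (Complex.I * (ν : ℂ)), mul_smul (Complex.I * _)]
      rw [integral_smul, PiLp.add_apply, PiLp.smul_apply, smul_eq_mul]
  have htw : ∀ (ν : ℝ),
      (∫ q, (((q.1 * χ q.1 : ℝ) : ℂ) * phase ν q.2) • twist (angularPart v) q
        ∂(polarMeasure 0 ω)) 0 = Complex.I *
      (∫ q, (((q.1 * χ q.1 : ℝ) : ℂ) * phase ν q.2) • angularPart v q ∂(polarMeasure 0 ω)) 0 ∧
      (∫ q, (((q.1 * χ q.1 : ℝ) : ℂ) * phase ν q.2) • twist (angularPart v) q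
        ∂(polarMeasure 0 ω)) 1 = -Complex.I *
      (∫ q, (((q.1 * χ q.1 : ℝ) : ℂ) * phase ν q.2) • angularPart v q ∂(polarMeasure 0 ω)) 1 :=
    fun ν => by
      have i1 := hχ.id_mul.integrable_smul_memLp (continuous_phase ν) ha
      have i2 := hχ.id_mul.integrable_smul_memLp (continuous_phase ν) (memLp_twist ha)
      have c : ∀ i, _ := fun i =>
        (EuclideanSpace.proj i : Spinor →L[ℂ] ℂ).integral_comp_comm i1
      have c' : ∀ i, _ := fun i =>
        (EuclideanSpace.proj i : Spinor →L[ℂ] ℂ).integral_comp_comm i2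
      simp only [PiLp.proj_apply, PiLp.smul_apply, smul_eq_mul] at c c'
      rw [← c 0, ← c 1, ← c' 0, ← c' 1, ← integral_const_mul, ← integral_const_mul]
      refine ⟨integral_congr_ae (Eventually.of_forall fun q => ?_),
        integral_congr_ae (Eventually.of_forall fun q => ?_)⟩ <;> simp [twist] <;> ring
  rw [integral_mul_radialMode (memLp_twist ha) hχ.id_mul, integral_mul_radialMode hu hχ,
    (htw μ).1, (htw (-μ)).2]
  have f0 := hform μ 0
  have f1 := hform (-μ) 1
  rw [Complex.ofReal_neg] at f1
  linear_combination Complex.I * f1 - Complex.I * f0 + Complex.I * hbd -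
    (μ : ℂ) * ((∫ q, ((χ q.1 : ℂ) * phase μ q.2) • ψ (polar q) ∂(polarMeasure 0 ω)) 0 +
      (∫ q, ((χ q.1 : ℂ) * phase (-μ) q.2) • ψ (polar q) ∂(polarMeasure 0 ω)) 1) * Complex.I_sq

theorem locallyIntegrableOn_of_memLp_radialMeasure {f : ℝ → ℂ} (hf : MemLp f 2 radialMeasure) :
    LocallyIntegrableOn f (Ioi 0) := by
  have hm := hf.1.mono_ac absolutelyContinuous_radialMeasure
  have hs := integrable_radialMeasure_iff.1 ((memLp_two_iff_integrable_sq_norm hf.1).1 hf)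
  exact locallyIntegrableOn_of_norm_le (locallyIntegrableOn_of_mul_sq hm.norm hs) hm
    (Eventually.of_forall fun r => by simp)

/-- The ordinary differential equation satisfied by the angular modes. -/
theorem radialMode_rotatedDirac_ae (hω0 : 0 < ω) (hω : ω ≤ 2 * Real.pi)
    (hψ : MemH1 (sector ω) ψ)
    (h₀ : IsEdgeTrace (sectorBetween 0 (ω / 2)) 0 ψ g₀)
    (b₀ : ∀ᵐ r ∂(volume.restrict (Ioi (0 : ℝ))), act (boundaryMatrix (-eth 0)) (g₀ r) = g₀ r)
    (h₁ : IsEdgeTrace (sectorBetween (ω / 2) ω) ω ψ g₁)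
    (b₁ : ∀ᵐ r ∂(volume.restrict (Ioi (0 : ℝ))), act (boundaryMatrix (eth ω)) (g₁ r) = g₁ r)
    (k : ℤ) :
    ∀ᵐ r ∂radialMeasure,
      radialMode ω (freq ω k) (rotatedDirac fun j => weakPartial (sector ω) j ψ) r =
      radialMode ω (freq ω k) (radialPart fun j => weakPartial (sector ω) j ψ) r +
        ((freq ω k / r : ℝ) : ℂ) * radialMode ω (freq ω k) (fun q => ψ (polar q)) r := by
  set v : Fin 2 → Plane → Spinor := fun j => weakPartial (sector ω) j ψ with hv
  have hu := memLp_comp_polar le_rfl hω hψ.1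
  have hr : MemLp (radialPart v) 2 (polarMeasure 0 ω) :=
    memLp_radialPart le_rfl hω fun j => (hψ.isWeakPartial j).1
  have ht : MemLp (twist (angularPart v)) 2 (polarMeasure 0 ω) :=
    memLp_twist (memLp_angularPart le_rfl hω fun j => (hψ.isWeakPartial j).1)
  set c := radialMode ω (freq ω k) fun q => ψ (polar q) with hc
  set t := radialMode ω (freq ω k) (twist (angularPart v)) with htd
  have lc : LocallyIntegrableOn c (Ioi 0) :=
    locallyIntegrableOn_of_memLp_radialMeasure (memLp_radialMode hω0 k hu)
  have lt : LocallyIntegrableOn t (Ioi 0) :=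
    locallyIntegrableOn_of_memLp_radialMeasure (memLp_radialMode hω0 k ht)
  have hG : LocallyIntegrableOn (fun r : ℝ => (r : ℂ) * t r - freq ω k * c r) (Ioi 0) := by
    refine LocallyIntegrableOn.sub ?_ ?_
    · exact lt.continuousOn_mul (Complex.continuous_ofReal.continuousOn)
        isOpen_Ioi.isLocallyClosed
    · exact lc.continuousOn_mul continuousOn_const isOpen_Ioi.isLocallyClosed
  have hzero := isOpen_Ioi.ae_eq_zero_of_integral_contDiff_smul_eq_zero hG fun χ h hcs hs => by
    have hχ : IsTest χ := ⟨h, hcs, hs⟩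
    have key := integral_mul_radialMode_twist hω0 hω hψ h₀ b₀ h₁ b₁ k hχ.div_id
    rw [← setIntegral_eq_integral_of_forall_compl_eq_zero (s := Ioi (0 : ℝ)) fun r hr => by
      rw [image_eq_zero_of_notMem_tsupport fun h => hr (hs h), zero_smul]]
    have int : ∀ {f : ℝ → ℂ}, LocallyIntegrableOn f (Ioi 0) →
        IntegrableOn (fun r => χ r • f r) (Ioi 0) := fun {f} hf => by
      have h1 := hf.integrableOn_compact_subset hs hcs.isCompact
      have h2 : IntegrableOn (fun r => χ r • f r) (tsupport χ) :=
        h1.continuousOn_smul h.continuous.continuousOn hcs.isCompact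
      refine (h2.integrable_of_forall_notMem_eq_zero fun r hr => ?_).integrableOn
      rw [image_eq_zero_of_notMem_tsupport hr, zero_smul]
    have k1 : ∫ r in Ioi 0, (r * (r * (χ r / r))) • t r = ∫ r in Ioi 0, χ r • ((r : ℂ) * t r) := by
      refine setIntegral_congr_fun measurableSet_Ioi fun r hr => ?_
      have h0 : r ≠ 0 := ne_of_gt hr
      simp only [mul_div_cancel₀ _ h0, Complex.real_smul]
      push_cast
      ring
    have k2 : ∫ r in Ioi 0, (r * (χ r / r)) • c r = ∫ r in Ioi 0, χ r • c r := by
      refine setIntegral_congr_fun measurableSet_Ioi fun r hr => ?_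
      have h0 : r ≠ 0 := ne_of_gt hr
      simp only [mul_div_cancel₀ _ h0]
    rw [k1, k2, ← integral_const_mul] at key
    simp only [smul_sub]
    rw [integral_sub, key, sub_eq_zero]
    · refine integral_congr_ae (Eventually.of_forall fun r => ?_)
      simp only [Complex.real_smul]
      ring
    · exact int (lt.continuousOn_mul (Complex.continuous_ofReal.continuousOn)
        isOpen_Ioi.isLocallyClosed)
    · exact int (lc.continuousOn_mul continuousOn_const isOpen_Ioi.isLocallyClosed)
  filter_upwards [radialMode_add_ae (μ := freq ω k) hr ht, ae_radialMeasure_pos,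
    radialMeasure_absolutelyContinuous.ae_le (ae_restrict_of_ae hzero)] with r e h0 hz
  have hz' := sub_eq_zero.1 (hz h0)
  have hne : (r : ℂ) ≠ 0 := by exact_mod_cast h0.ne'
  refine e.trans ?_
  congr 1
  push_cast
  rw [div_mul_eq_mul_div, eq_div_iff hne, ← hz', mul_comm]

theorem lintegral_sector_eq (hω : ω ≤ 2 * Real.pi) {f : Plane → ENNReal}
    (hf : AEMeasurable f (volume.restrict (sector ω))) :
    ∫⁻ x in sector ω, f x = ∫⁻ r, ∫⁻ θ, f (polar (r, θ)) ∂(arc 0 ω) ∂radialMeasure := by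
  have h := measurePreserving_polar le_rfl hω
  have hf' : AEMeasurable f (Measure.map polar (polarMeasure 0 ω)) := by rw [h.map_eq]; exact hf
  have := lintegral_map' hf' h.measurable.aemeasurable
  rw [h.map_eq] at this
  rw [sector, this]
  exact lintegral_prod _ (hf'.comp_measurable h.measurable)

end domain

end DiracSector

theorem theorem1p3 (ω : ℝ) (hω0 : 0 < ω) (hω : ω ≤ 2 * Real.pi)
    (ψ : DiracSector.Plane → DiracSector.Spinor) (hψ : ψ ∈ DiracSector.diracDomain ω) :
    ENNReal.ofReal ((Real.pi - ω) ^ 2 / (4 * ω ^ 2)) *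
        ∫⁻ x in DiracSector.sector ω, ENNReal.ofReal (‖ψ x‖ ^ 2 / ‖x‖ ^ 2) ≤
      ∫⁻ x in DiracSector.sector ω,
        ENNReal.ofReal (‖DiracSector.sigmaGrad (DiracSector.sector ω) ψ x‖ ^ 2) := by
  open DiracSector in
  obtain ⟨hH, ⟨g₀, h₀, b₀⟩, g₁, h₁, b₁⟩ := hψ
  set v : Fin 2 → Plane → Spinor := fun j => weakPartial (sector ω) j ψ with hv
  have hvL : ∀ j, MemLp (v j) 2 (volume.restrict (sector ω)) := fun j => (hH.isWeakPartial j).1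
  have hu := memLp_comp_polar le_rfl hω hH.1
  have hD : MemLp (rotatedDirac v) 2 (polarMeasure 0 ω) :=
    (memLp_radialPart le_rfl hω hvL).add (memLp_twist (memLp_angularPart le_rfl hω hvL))
  have hcpos : ENNReal.ofReal (2 * ω) ≠ 0 := (ENNReal.ofReal_pos.2 (by positivity)).ne'
  have hL : ENNReal.ofReal (2 * ω) *
      ∫⁻ x in sector ω, ENNReal.ofReal (‖ψ x‖ ^ 2 / ‖x‖ ^ 2) =
      ∑' k : ℤ, ∫⁻ r, ENNReal.ofReal (‖radialMode ω (freq ω k) (fun q => ψ (polar q)) r‖ ^ 2 /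
        r ^ 2) ∂radialMeasure := by
    have hm : AEMeasurable (fun x => ENNReal.ofReal (‖ψ x‖ ^ 2 / ‖x‖ ^ 2))
        (volume.restrict (sector ω)) :=
      ((hH.1.1.norm.pow 2).aemeasurable.div (by fun_prop)).ennreal_ofReal
    have hmk : ∀ k : ℤ, AEMeasurable (fun r => ENNReal.ofReal
        (‖radialMode ω (freq ω k) (fun q => ψ (polar q)) r‖ ^ 2 / r ^ 2)) radialMeasure := fun k =>
      (((aestronglyMeasurable_radialMode hu).norm.pow 2).aemeasurable.div
        (by fun_prop)).ennreal_ofReal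
    rw [lintegral_sector_eq hω hm, ← lintegral_const_mul' _ _ ENNReal.ofReal_ne_top,
      ← lintegral_tsum hmk]
    refine lintegral_congr_ae ?_
    filter_upwards [ae_tsum_radialMode hω0 hu, ae_radialMeasure_pos] with r hr h0
    have hsc : ∀ a : ℝ, ENNReal.ofReal (a / r ^ 2) = ENNReal.ofReal ((r ^ 2)⁻¹) *
        ENNReal.ofReal a := fun a => by
      rw [← ENNReal.ofReal_mul (by positivity), inv_mul_eq_div]
    simp only [norm_polar, sq_abs, hsc]
    rw [ENNReal.tsum_mul_left, hr, lintegral_const_mul' _ _ ENNReal.ofReal_ne_top,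
      mul_left_comm]
  have hR : ENNReal.ofReal (2 * ω) *
      ∫⁻ x in sector ω, ENNReal.ofReal (‖sigmaGrad (sector ω) ψ x‖ ^ 2) =
      ∑' k : ℤ, ∫⁻ r, ENNReal.ofReal (‖radialMode ω (freq ω k) (rotatedDirac v) r‖ ^ 2)
        ∂radialMeasure := by
    have hact : ∀ (A : Matrix (Fin 2) (Fin 2) ℂ) (f : Plane → Spinor),
        AEStronglyMeasurable f (volume.restrict (sector ω)) →
        AEStronglyMeasurable (fun x => act A (f x)) (volume.restrict (sector ω)) :=
      fun A f hf => by
        have : Continuous (act A) := (Matrix.toEuclideanLin A).continuous_of_finiteDimensional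
        exact this.comp_aestronglyMeasurable hf
    have hm : AEMeasurable (fun x => ENNReal.ofReal (‖sigmaGrad (sector ω) ψ x‖ ^ 2))
        (volume.restrict (sector ω)) :=
      aemeasurable_ofReal_sq ((hact _ _ (hvL 0).1).add (hact _ _ (hvL 1).1))
    rw [lintegral_sector_eq hω hm, ← lintegral_const_mul' _ _ ENNReal.ofReal_ne_top,
      ← lintegral_tsum fun k => aemeasurable_ofReal_sq (aestronglyMeasurable_radialMode hD)]
    refine lintegral_congr_ae ?_
    filter_upwards [ae_tsum_radialMode hω0 hD] with r hr
    rw [hr]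
    simp only [norm_rotatedDirac_sq]
    rfl
  rw [← ENNReal.mul_le_mul_iff_right hcpos ENNReal.ofReal_ne_top, mul_left_comm, hL, hR,
    ← ENNReal.tsum_mul_left]
  refine ENNReal.tsum_le_tsum fun k => ?_
  calc _ ≤ ENNReal.ofReal (freq ω k ^ 2) * ∫⁻ r, ENNReal.ofReal
          (‖radialMode ω (freq ω k) (fun q => ψ (polar q)) r‖ ^ 2 / r ^ 2) ∂radialMeasure :=
        mul_le_mul_left (ENNReal.ofReal_le_ofReal (freq_zero_sq_le hω0 hω k)) _
    _ ≤ _ := radial_inequality (aestronglyMeasurable_radialMode hu)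
        (memLp_radialMode hω0 k (memLp_radialPart le_rfl hω hvL)) (memLp_radialMode hω0 k hD)
        (radialMode_rotatedDirac_ae hω0 hω hH h₀ b₀ h₁ b₁ k)
        fun χ hχ => weakDeriv_radialMode hω0 hω hH h₀ h₁ _ hχ
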